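/- For positive integers $s_1,\dots,s_\ell$ with $s_\ell>1$, the multiple $t$-value is the convergent series $$t(s_1,\dots,s_\ell)=\sum_{1\le k_1<k_2<\cdots<k_\ell}\frac{1}{(2k_1-1)^{s_1}(2k_2-1)^{s_2}\cdots(2k_\ell-1)^{s_\ell}},$$ and $\{2\}^n$ denotes the string $2,\dots,2$ with $n$ repetitions. Let $\zeta$ be the Riemann zeta function. **Theorem.** For every integer $n\ge 0$ the series defining $t(3,\{2\}^n,3)$ converges, and $$\begin{aligned} t(3,\{2\}^n,3)=\Big(-\frac14\Big)^{n+2}\Big\{&-\frac{9+6n}{2}\,\zeta(2)\,\zeta(2n+4)\\ &+\sum_{\substack{q+r+s=n+2\\ q,r,s\ge1}}2rs\,(2-2^{-2r}-2^{-2s})\,\zeta(2r+1)\,\zeta(2s+1)\cdot(-1)^q\frac{\pi^{2q}}{(2q)!}\\ &+\sum_{\substack{r+s=n+2\\ r,s\ge1}}2rs\,(2-2^{-2r})(2-2^{-2s})\,\zeta(2r+1)\,\zeta(2s+1)\Big\}. \end{aligned}$$ In particular, $t(3,\{2\}^n,3)$ is a polynomial with rational coefficients in the Riemann zeta values $\zeta(k)$,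 $k\ge2$. -/

import Mathlib

namespace MultipleT

/-- The index set of the series for a multiple `t`-value of depth `ℓ`: the tuples of integers
`1 ≤ k₁ < k₂ < ⋯ < k_ℓ`. -/
abbrev Index (l : ℕ) : Type :=
  {k : Fin l → ℕ // StrictMono k ∧ ∀ i, 1 ≤ k i}

/-- The general term `∏ i, 1 / (2 kᵢ - 1) ^ sᵢ` of the series `t(s₁, …, s_ℓ)`. -/
noncomputable def tTerm (s : List ℕ) (k : Index s.length) : ℝ :=
  ∏ i : Fin s.length, 1 / (2 * (k.1 i : ℝ) - 1) ^ s.get i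

/-- The multiple `t`-value
`t(s₁, …, s_ℓ) = ∑_{1 ≤ k₁ < ⋯ < k_ℓ} 1 / ((2k₁ - 1)^{s₁} ⋯ (2k_ℓ - 1)^{s_ℓ})`. -/
noncomputable def tValue (s : List ℕ) : ℝ :=
  ∑' k : Index s.length, tTerm s k

/-- The argument string `(3, {2}^n, 3)`, with `n` repetitions of `2`. -/
def string323 (n : ℕ) : List ℕ :=
  [3] ++ List.replicate n 2 ++ [3]

end MultipleT

/-!
The nested sum is first turned into a double integral. With `s_k = c_k sin θ ^ (2 k + 1)`, normalized
to have integral `1` over `(0, π/2)`, the functions `v_k = s_k / (2 k + 1) ^ 2` satisfy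
`v_{k+1}'' = s_k - s_{k+1}`. Hence a twofold integration from `0` maps `s_k` to `∑_{j > k} v_j`
(`primitive_primitive_sineMode`), so that each entry `2` of the argument string is a twofold
integration, while the two entries `3` account for the factors `φ cot φ` and `(π/2 - θ) cot θ`. By
Cauchy's formula for iterated integrals (`tailSum_string323`, `tValue_string323`),
`t(3, {2}ⁿ, 3) = ∫∫ (π/2 - θ) cot θ · φ cot φ · (θ - φ) ^ (2 n + 2) / (2 n + 2)!` over the triangle
`0 < φ < θ < π/2`.

Consequently `K(x) = ∑ (-1)ⁿ t(3, {2}ⁿ, 3) x ^ (2 n + 2)` is the integral of `1 - cos (x (θ - φ))`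
against a finite measure. The addition formula
`sin (θ - φ) cot θ cot φ = cos (θ - φ) (cot φ - cot θ) - sin (θ - φ)` makes the difference
`K(x + 2) - K(x)` a sum of one-dimensional integrals (`generating_add_two`), and these are
evaluated by the partial fraction expansion of a Dirichlet kernel (`cotTransform_two_mul`). An
explicit expression in trigamma values, `closedForm`, satisfies the same difference equation; since
`K` has a limit at infinity by the Riemann–Lebesgue lemma and `closedForm` tends to `0`, the
difference of the two is constant (`generating_two_mul`).

Expanding the closed form at `0` gives
`8 cos² (π z / 2) U (U - V) + 2 V²` with `U = ∑ r ζ(2 r + 1) z ^ (2 r)` and `V(z) = U(z / 2)`, plus a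
series in even zeta values and a constant multiple of `z²` (`tValueSeries_eq`). Comparing the
coefficients of `z ^ (2 n + 4)` yields the formula, from which membership in the algebra of zeta
values can be read off.
-/

namespace MultipleT

open MeasureTheory Set Filter Topology
open scoped ENNReal

/-! ### Nested sums with values in `ℝ≥0∞` -/

/-- The sum of `∏ 1 / (2 kᵢ - 1) ^ sᵢ` over all tuples `N < k₁ < ⋯ < k_ℓ`, defined by summing over
the smallest index `k₁ = N + 1 + j` last. -/
noncomputable def tailSum : List ℕ → ℕ → ℝ≥0∞
  | [], _ => 1
  | s :: l, N =>
    ∑' j : ℕ, ENNReal.ofReal (1 / (2 * ((N + j : ℕ) : ℝ) + 1) ^ s) * tailSum l (N + j + 1)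

/-- Strictly increasing tuples of integers above `N`; for `N = 0` this is `Index l`. -/
abbrev IndexAbove (l N : ℕ) : Type :=
  {k : Fin l → ℕ // StrictMono k ∧ ∀ i, N < k i}

/-- Prepending the smallest entry `N + 1 + j`. -/
def consIndex (l N : ℕ) (x : Σ j : ℕ, IndexAbove l (N + j + 1)) : IndexAbove (l + 1) N :=
  ⟨Fin.cons (N + x.1 + 1) x.2.1, by
    refine ⟨?_, ?_⟩
    · intro i i' h
      induction i' using Fin.cases with
      | zero => exact absurd h (Fin.not_lt_zero i)
      | succ i' =>
        induction i using Fin.cases with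
        | zero => simpa using x.2.2.2 i'
        | succ i => simpa using x.2.2.1 (Fin.succ_lt_succ_iff.mp h)
    · intro i
      induction i using Fin.cases with
      | zero => simp
      | succ i =>
        have := x.2.2.2 i
        simp only [Fin.cons_succ]
        omega⟩

theorem consIndex_bijective (l N : ℕ) : Function.Bijective (consIndex l N) := by
  constructor
  · rintro ⟨j, k, hk⟩ ⟨j', k', hk'⟩ h
    have h1 := congrArg Subtype.val h
    simp only [consIndex] at h1
    obtain ⟨h2, rfl⟩ := Fin.cons_injective2 h1
    obtain rfl : j = j' := by omega
    rfl
  · rintro ⟨k, hk, hN⟩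
    have h0 := hN 0
    have e : N + (k 0 - (N + 1)) + 1 = k 0 := by omega
    refine ⟨⟨k 0 - (N + 1), Fin.tail k, ?_, ?_⟩, ?_⟩
    · exact fun i j hij => hk (Fin.succ_lt_succ_iff.mpr hij)
    · intro i
      rw [e]
      exact hk (Fin.succ_pos i)
    · apply Subtype.ext
      simp only [consIndex, e]
      exact Fin.cons_self_tail k

/-- Summing over the tuples of `IndexAbove` by their smallest entry. -/
theorem tsum_indexAbove (s : List ℕ) (N : ℕ) :
    ∑' k : IndexAbove s.length N,
      ∏ i, ENNReal.ofReal (1 / (2 * (k.1 i : ℝ) - 1) ^ s.get i) = tailSum s N := by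
  induction s generalizing N with
  | nil =>
    have : Unique (IndexAbove ([] : List ℕ).length N) :=
      { default := ⟨Fin.elim0, fun i => i.elim0, fun i => i.elim0⟩
        uniq := fun k => Subtype.ext (funext fun i => i.elim0) }
    rw [tsum_fintype]
    simp [tailSum]
  | cons a l ih =>
    have hb := consIndex_bijective l.length N
    rw [tailSum]
    refine ((Equiv.ofBijective _ hb).tsum_eq (f := fun k : IndexAbove (a :: l).length N =>
      ∏ i, ENNReal.ofReal (1 / (2 * (k.1 i : ℝ) - 1) ^ (a :: l).get i))).symm.trans ?_
    rw [ENNReal.tsum_sigma']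
    refine tsum_congr fun j => ?_
    rw [← ih, ← ENNReal.tsum_mul_left]
    refine tsum_congr fun k => ?_
    change ∏ i : Fin (l.length + 1), _ = _
    rw [Fin.prod_univ_succ]
    congr 1
    simp only [Equiv.ofBijective_apply, consIndex, Fin.cons_zero, List.get_cons_zero]
    congr 3
    push_cast
    ring

theorem tTerm_nonneg (s : List ℕ) (k : Index s.length) : 0 ≤ tTerm s k := by
  refine Finset.prod_nonneg fun i _ => ?_
  have h : (1 : ℝ) ≤ k.1 i := by exact_mod_cast k.2.2 i
  have : (0 : ℝ) ≤ 2 * (k.1 i : ℝ) - 1 := by linarith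
  positivity

theorem tsum_ofReal_tTerm (s : List ℕ) :
    ∑' k, ENNReal.ofReal (tTerm s k) = tailSum s 0 := by
  rw [← tsum_indexAbove]
  refine tsum_congr fun k => ?_
  rw [tTerm, ENNReal.ofReal_prod_of_nonneg]
  intro i _
  have h : (1 : ℝ) ≤ k.1 i := by exact_mod_cast k.2.2 i
  have : (0 : ℝ) ≤ 2 * (k.1 i : ℝ) - 1 := by linarith
  positivity

theorem summable_tTerm {s : List ℕ} (h : tailSum s 0 ≠ ∞) : Summable (tTerm s) := by
  rw [← tsum_ofReal_tTerm] at h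
  simpa [ENNReal.toReal_ofReal (tTerm_nonneg s _)] using ENNReal.summable_toReal h

theorem tValue_eq_toReal (s : List ℕ) : tValue s = (tailSum s 0).toReal := by
  rw [← tsum_ofReal_tTerm, ENNReal.tsum_toReal_eq (fun _ => ENNReal.ofReal_ne_top), tValue]
  exact tsum_congr fun k => (ENNReal.toReal_ofReal (tTerm_nonneg s k)).symm

/-! ### Iterated integrals of powers of the sine -/

/-- The integral of `f` over `(0, θ)`, as an operator on functions with values in `ℝ≥0∞`. -/
noncomputable def primitive (f : ℝ → ℝ≥0∞) (θ : ℝ) : ℝ≥0∞ :=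
  ∫⁻ φ in Ioo 0 θ, f φ

theorem measurable_primitive (f : ℝ → ℝ≥0∞) : Measurable (primitive f) :=
  Monotone.measurable fun _ _ h => lintegral_mono_set (Ioo_subset_Ioo_right h)

theorem primitive_congr {f g : ℝ → ℝ≥0∞} {T : ℝ} (h : ∀ θ ∈ Ioo 0 T, f θ = g θ) {θ : ℝ}
    (hθ : θ ≤ T) : primitive f θ = primitive g θ :=
  setLIntegral_congr_fun measurableSet_Ioo fun φ hφ => h φ ⟨hφ.1, hφ.2.trans_le hθ⟩

theorem primitive_tsum {f : ℕ → ℝ → ℝ≥0∞} (hf : ∀ i, Measurable (f i)) :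
    primitive (fun θ => ∑' i, f i θ) = fun θ => ∑' i, primitive (f i) θ := by
  funext θ
  exact lintegral_tsum fun i => (hf i).aemeasurable

theorem primitive_const_mul (c : ℝ≥0∞) {f : ℝ → ℝ≥0∞} (hf : Measurable f) :
    primitive (fun θ => c * f θ) = fun θ => c * primitive f θ := by
  funext θ
  exact lintegral_const_mul c hf

theorem measurable_iterate_primitive {f : ℝ → ℝ≥0∞} (hf : Measurable f) (m : ℕ) :
    Measurable (primitive^[m] f) := by
  cases m with
  | zero => exact hf
  | succ m => rw [Function.iterate_succ_apply']; exact measurable_primitive _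

theorem iterate_primitive_congr {f g : ℝ → ℝ≥0∞} {T : ℝ} (h : ∀ θ ∈ Ioo 0 T, f θ = g θ) (m : ℕ) :
    ∀ θ ∈ Ioo 0 T, primitive^[m] f θ = primitive^[m] g θ := by
  induction m with
  | zero => exact h
  | succ m ih =>
    intro θ hθ
    rw [Function.iterate_succ_apply', Function.iterate_succ_apply']
    exact primitive_congr ih hθ.2.le

theorem iterate_primitive_tsum_mul (c : ℕ → ℝ≥0∞) {f : ℕ → ℝ → ℝ≥0∞} (hf : ∀ i, Measurable (f i))
    (m : ℕ) : primitive^[m] (fun θ => ∑' i, c i * f i θ) =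
      fun θ => ∑' i, c i * primitive^[m] (f i) θ := by
  induction m with
  | zero => rfl
  | succ m ih =>
    simp only [Function.iterate_succ_apply', ih]
    rw [primitive_tsum fun i => (measurable_iterate_primitive (hf i) m).const_mul (c i)]
    simp only [primitive_const_mul _ (measurable_iterate_primitive (hf _) m)]

/-- The fundamental theorem of calculus for a nonnegative derivative. -/
theorem primitive_ofReal {g G : ℝ → ℝ} {T : ℝ} (hT : 0 ≤ T) (hg : Continuous g)
    (hG : ∀ θ, HasDerivAt G (g θ) θ) (h0 : G 0 = 0) (hpos : ∀ θ ∈ Ioo 0 T, 0 ≤ g θ) :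
    primitive (fun θ => ENNReal.ofReal (g θ)) T = ENNReal.ofReal (G T) := by
  have h1 : ∫ θ in (0 : ℝ)..T, g θ = G T := by
    rw [intervalIntegral.integral_eq_sub_of_hasDerivAt (fun θ _ => hG θ)
      (hg.intervalIntegrable _ _), h0, sub_zero]
  rw [← h1, intervalIntegral.integral_of_le hT, integral_Ioc_eq_integral_Ioo, primitive,
    ofReal_integral_eq_lintegral_ofReal]
  · exact (hg.integrableOn_Icc (a := 0) (b := T)).mono_set Ioo_subset_Icc_self
  · exact (ae_restrict_iff' measurableSet_Ioo).mpr (ae_of_all _ hpos)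

/-- Cauchy's formula for iterated integrals. -/
theorem iterate_primitive_eq {f : ℝ → ℝ≥0∞} (hf : Measurable f) (m : ℕ) (θ : ℝ) :
    primitive^[m + 1] f θ =
      ∫⁻ φ in Ioo 0 θ, ENNReal.ofReal ((θ - φ) ^ m / m.factorial) * f φ := by
  induction m generalizing θ with
  | zero => simp [primitive]
  | succ m ih =>
    rw [Function.iterate_succ_apply', primitive]
    simp only [ih]
    have e1 : ∀ ψ ∈ Ioo 0 θ,
        ∫⁻ φ in Ioo 0 ψ, ENNReal.ofReal ((ψ - φ) ^ m / m.factorial) * f φ =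
        ∫⁻ φ in Ioo 0 θ, (Ioi φ).indicator
          (fun ψ => ENNReal.ofReal ((ψ - φ) ^ m / m.factorial) * f φ) ψ := by
      intro ψ hψ
      rw [← lintegral_indicator measurableSet_Ioo, ← lintegral_indicator measurableSet_Ioo]
      refine lintegral_congr fun φ => ?_
      have := hψ.2
      simp only [indicator, mem_Ioo, mem_Ioi]
      split_ifs <;> first | rfl | (exfalso; grind)
    rw [setLIntegral_congr_fun measurableSet_Ioo e1, lintegral_lintegral_swap]
    · refine setLIntegral_congr_fun measurableSet_Ioo fun φ hφ => ?_
      rw [lintegral_indicator measurableSet_Ioi, Measure.restrict_restrict measurableSet_Ioi,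
        lintegral_mul_const _ (by fun_prop)]
      congr 1
      have e2 : Ioi φ ∩ Ioo 0 θ = Ioo φ θ := by
        ext ψ
        have := hφ.1
        simp only [mem_inter_iff, mem_Ioi, mem_Ioo]
        grind
      rw [e2, ← ofReal_integral_eq_lintegral_ofReal, ← integral_Ioc_eq_integral_Ioo,
        ← intervalIntegral.integral_of_le hφ.2.le]
      · congr 1
        simp only [intervalIntegral.integral_div]
        rw [intervalIntegral.integral_comp_sub_right (fun u => u ^ m), integral_pow]
        rw [Nat.factorial_succ]
        push_cast
        have : (m.factorial : ℝ) ≠ 0 := by positivity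
        field_simp
        simp
      · have : Continuous fun ψ : ℝ => (ψ - φ) ^ m / (m.factorial : ℝ) := by fun_prop
        exact (this.integrableOn_Icc (a := φ) (b := θ)).mono_set Ioo_subset_Icc_self
      · refine (ae_restrict_iff' measurableSet_Ioo).mpr (ae_of_all _ fun ψ hψ => ?_)
        have : 0 ≤ ψ - φ := by linarith [hψ.1]
        simp only [Pi.zero_apply]
        positivity
    · apply Measurable.aemeasurable
      have : (Function.uncurry fun ψ φ => (Ioi φ).indicator
          (fun ψ => ENNReal.ofReal ((ψ - φ) ^ m / m.factorial) * f φ) ψ) =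
          {p : ℝ × ℝ | p.2 < p.1}.indicator
            (fun p => ENNReal.ofReal ((p.1 - p.2) ^ m / m.factorial) * f p.2) := by
        ext ⟨a, b⟩
        simp [indicator]
      rw [this]
      refine Measurable.indicator ?_ (measurableSet_lt measurable_snd measurable_fst)
      fun_prop

/-- The inverse of the Wallis integral `∫ θ in 0..π/2, sin θ ^ (2 k + 1)`. -/
noncomputable def wallisCoeff (k : ℕ) : ℝ :=
  ∏ i ∈ Finset.range k, (2 * (i : ℝ) + 3) / (2 * i + 2)

theorem wallisCoeff_succ (k : ℕ) :
    wallisCoeff (k + 1) = wallisCoeff k * ((2 * (k : ℝ) + 3) / (2 * k + 2)) :=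
  Finset.prod_range_succ _ _

theorem wallisCoeff_nonneg (k : ℕ) : 0 ≤ wallisCoeff k :=
  Finset.prod_nonneg fun i _ => by positivity

theorem wallisCoeff_le (k : ℕ) : wallisCoeff k ≤ 2 * k + 1 := by
  induction k with
  | zero => simp [wallisCoeff]
  | succ k ih =>
    rw [wallisCoeff_succ]
    have h : (2 * (k : ℝ) + 3) / (2 * k + 2) ≤ (2 * k + 3) / (2 * k + 1) := by gcongr; norm_num
    calc wallisCoeff k * ((2 * (k : ℝ) + 3) / (2 * k + 2))
        ≤ (2 * k + 1) * ((2 * k + 3) / (2 * k + 1)) :=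
          mul_le_mul ih h (by positivity) (by positivity)
      _ = 2 * ((k + 1 : ℕ) : ℝ) + 1 := by push_cast; field_simp; ring

/-- The function `sin θ ^ (2 k + 1)`, normalized to have integral `1` over `(0, π/2)`. -/
noncomputable def sineMode (k : ℕ) (θ : ℝ) : ℝ := wallisCoeff k * Real.sin θ ^ (2 * k + 1)

/-- The derivative of `sineMode k θ / (2 k + 1) ^ 2`. -/
noncomputable def sineModeDeriv (k : ℕ) (θ : ℝ) : ℝ :=
  wallisCoeff k / (2 * k + 1) * (Real.sin θ ^ (2 * k) * Real.cos θ)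

theorem continuous_sineMode (k : ℕ) : Continuous (sineMode k) := by
  unfold sineMode; fun_prop

theorem continuous_sineModeDeriv (k : ℕ) : Continuous (sineModeDeriv k) := by
  unfold sineModeDeriv; fun_prop

theorem sineMode_nonneg {θ : ℝ} (h : θ ∈ Icc 0 (Real.pi / 2)) (k : ℕ) : 0 ≤ sineMode k θ :=
  mul_nonneg (wallisCoeff_nonneg k)
    (pow_nonneg (Real.sin_nonneg_of_nonneg_of_le_pi h.1 (by linarith [h.2, Real.pi_pos])) _)

theorem hasDerivAt_sineMode_div (k : ℕ) (θ : ℝ) :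
    HasDerivAt (fun θ => sineMode k θ / (2 * k + 1) ^ 2) (sineModeDeriv k θ) θ := by
  unfold sineMode sineModeDeriv
  have h := (((Real.hasDerivAt_sin θ).pow (2 * k + 1)).const_mul (wallisCoeff k)).div_const
    ((2 * (k : ℝ) + 1) ^ 2)
  refine h.congr_deriv ?_
  have : (2 * (k : ℝ) + 1) ≠ 0 := by positivity
  rw [Nat.add_sub_cancel]
  push_cast
  field_simp

/-- The recursion `v'' = s_k - s_{k+1}` for `v = s_{k+1} / (2 k + 3) ^ 2`, where `s_k` is
`sineMode k`: this is what the normalization achieves. -/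
theorem hasDerivAt_sineModeDeriv_succ (k : ℕ) (θ : ℝ) :
    HasDerivAt (sineModeDeriv (k + 1)) (sineMode k θ - sineMode (k + 1) θ) θ := by
  unfold sineMode sineModeDeriv
  have h := ((((Real.hasDerivAt_sin θ).pow (2 * (k + 1))).mul (Real.hasDerivAt_cos θ))).const_mul
    (wallisCoeff (k + 1) / (2 * ((k + 1 : ℕ) : ℝ) + 1))
  refine h.congr_deriv ?_
  rw [wallisCoeff_succ]
  have h2 : Real.cos θ * Real.cos θ = 1 - Real.sin θ ^ 2 := by
    rw [← Real.cos_sq', sq]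
  have e : 2 * (k + 1) - 1 = 2 * k + 1 := by omega
  rw [e, Pi.pow_apply]
  push_cast
  have h3 : (2 * (k : ℝ) + 2) ≠ 0 := by positivity
  have h4 : (2 * ((k : ℝ) + 1) + 1) ≠ 0 := by positivity
  have h5 : ((k : ℝ) + 1) ≠ 0 := by positivity
  rw [show (2 * ((k : ℝ) + 1) * Real.sin θ ^ (2 * k + 1) * Real.cos θ) * Real.cos θ =
    2 * ((k : ℝ) + 1) * Real.sin θ ^ (2 * k + 1) * (1 - Real.sin θ ^ 2) by rw [← h2]; ring]
  field_simp
  ring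

/-- The primitive of `sineMode k` vanishing at `0`. -/
noncomputable def sineModeInt (k : ℕ) (θ : ℝ) : ℝ :=
  1 - ∑ j ∈ Finset.range (k + 1), sineModeDeriv j θ

/-- The twofold primitive of `sineMode k` vanishing at `0` with its derivative. -/
noncomputable def sineModeIntInt (k : ℕ) (θ : ℝ) : ℝ :=
  θ - ∑ j ∈ Finset.range (k + 1), sineMode j θ / (2 * j + 1) ^ 2

theorem sineModeInt_succ (k : ℕ) (θ : ℝ) :
    sineModeInt (k + 1) θ = sineModeInt k θ - sineModeDeriv (k + 1) θ := by
  rw [sineModeInt, sineModeInt, Finset.sum_range_succ]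
  ring

theorem continuous_sineModeInt (k : ℕ) : Continuous (sineModeInt k) := by
  unfold sineModeInt
  exact continuous_const.sub (continuous_finsetSum _ fun j _ => continuous_sineModeDeriv j)

theorem hasDerivAt_sineModeInt (k : ℕ) (θ : ℝ) :
    HasDerivAt (sineModeInt k) (sineMode k θ) θ := by
  induction k with
  | zero =>
    have h := (Real.hasDerivAt_cos θ).const_sub 1
    have e : sineModeInt 0 = fun θ => 1 - Real.cos θ := by
      funext θ; simp [sineModeInt, sineModeDeriv, wallisCoeff]
    rw [e]
    simpa [sineMode, wallisCoeff] using h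
  | succ k ih =>
    have e : sineModeInt (k + 1) = fun θ => sineModeInt k θ - sineModeDeriv (k + 1) θ :=
      funext (sineModeInt_succ k)
    rw [e]
    exact (ih.sub (hasDerivAt_sineModeDeriv_succ k θ)).congr_deriv (by ring)

theorem hasDerivAt_sineModeIntInt (k : ℕ) (θ : ℝ) :
    HasDerivAt (sineModeIntInt k) (sineModeInt k θ) θ := by
  unfold sineModeIntInt sineModeInt
  exact (hasDerivAt_id θ).sub (HasDerivAt.fun_sum fun j _ => hasDerivAt_sineMode_div j θ)

theorem sineModeInt_zero (k : ℕ) : sineModeInt k 0 = 0 := by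
  induction k with
  | zero => simp [sineModeInt, sineModeDeriv, wallisCoeff]
  | succ k ih => rw [sineModeInt_succ, ih]; simp [sineModeDeriv]

theorem sineModeInt_pi_div_two (k : ℕ) : sineModeInt k (Real.pi / 2) = 1 := by
  simp [sineModeInt, sineModeDeriv]

theorem sineModeIntInt_zero (k : ℕ) : sineModeIntInt k 0 = 0 := by
  simp [sineModeIntInt, sineMode]

theorem integral_sineMode (k : ℕ) (θ : ℝ) : ∫ φ in (0 : ℝ)..θ, sineMode k φ = sineModeInt k θ := by
  rw [intervalIntegral.integral_eq_sub_of_hasDerivAt (fun θ _ => hasDerivAt_sineModeInt k θ)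
    ((continuous_sineMode k).intervalIntegrable _ _), sineModeInt_zero, sub_zero]

theorem integral_sineModeInt (k : ℕ) (θ : ℝ) :
    ∫ φ in (0 : ℝ)..θ, sineModeInt k φ = sineModeIntInt k θ := by
  rw [intervalIntegral.integral_eq_sub_of_hasDerivAt (fun θ _ => hasDerivAt_sineModeIntInt k θ)
    ((continuous_sineModeInt k).intervalIntegrable _ _), sineModeIntInt_zero, sub_zero]

theorem sineModeInt_nonneg {θ : ℝ} (h : θ ∈ Icc 0 (Real.pi / 2)) (k : ℕ) :
    0 ≤ sineModeInt k θ := by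
  rw [← integral_sineMode]
  exact intervalIntegral.integral_nonneg h.1 fun φ hφ =>
    sineMode_nonneg ⟨hφ.1, hφ.2.trans h.2⟩ k

theorem sineModeIntInt_nonneg {θ : ℝ} (h : θ ∈ Icc 0 (Real.pi / 2)) (k : ℕ) :
    0 ≤ sineModeIntInt k θ := by
  rw [← integral_sineModeInt]
  exact intervalIntegral.integral_nonneg h.1 fun φ hφ =>
    sineModeInt_nonneg ⟨hφ.1, hφ.2.trans h.2⟩ k

theorem sineMode_mono {θ φ : ℝ} (h0 : 0 ≤ φ) (h : φ ≤ θ) (h1 : θ ≤ Real.pi / 2) (k : ℕ) :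
    sineMode k φ ≤ sineMode k θ := by
  refine mul_le_mul_of_nonneg_left (pow_le_pow_left₀ ?_ ?_ _) (wallisCoeff_nonneg k)
  · exact Real.sin_nonneg_of_nonneg_of_le_pi h0 (by linarith [Real.pi_pos])
  · exact Real.sin_le_sin_of_le_of_le_pi_div_two (by linarith [Real.pi_pos]) h1 h

theorem sineModeInt_le {θ : ℝ} (h : θ ∈ Icc 0 (Real.pi / 2)) (k : ℕ) :
    sineModeInt k θ ≤ sineMode k θ * θ := by
  rw [← integral_sineMode]
  calc ∫ φ in (0 : ℝ)..θ, sineMode k φ ≤ ∫ φ in (0 : ℝ)..θ, sineMode k θ :=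
        intervalIntegral.integral_mono_on h.1 ((continuous_sineMode k).intervalIntegrable _ _)
          (by simp) fun φ hφ => sineMode_mono hφ.1 hφ.2 h.2 k
    _ = sineMode k θ * θ := by simp [mul_comm]

theorem sineModeIntInt_le {θ : ℝ} (h : θ ∈ Icc 0 (Real.pi / 2)) (k : ℕ) :
    sineModeIntInt k θ ≤ sineMode k θ * θ * θ := by
  rw [← integral_sineModeInt]
  calc ∫ φ in (0 : ℝ)..θ, sineModeInt k φ ≤ ∫ φ in (0 : ℝ)..θ, sineMode k θ * θ := by
        refine intervalIntegral.integral_mono_on h.1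
          ((continuous_sineModeInt k).intervalIntegrable _ _) (by simp) fun φ hφ => ?_
        refine (sineModeInt_le ⟨hφ.1, hφ.2.trans h.2⟩ k).trans ?_
        exact mul_le_mul (sineMode_mono hφ.1 hφ.2 h.2 k) hφ.2 hφ.1 (sineMode_nonneg h k)
    _ = sineMode k θ * θ * θ := by simp [mul_comm]

theorem tendsto_sineMode {θ : ℝ} (h : θ ∈ Ioo 0 (Real.pi / 2)) :
    Tendsto (fun k => sineMode k θ) atTop (𝓝 0) := by
  have hs0 : 0 ≤ Real.sin θ :=
    Real.sin_nonneg_of_nonneg_of_le_pi h.1.le (by linarith [h.2, Real.pi_pos])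
  have hs1 : Real.sin θ < 1 := by
    have := Real.sin_lt_sin_of_lt_of_le_pi_div_two (by linarith [h.1, Real.pi_pos]) le_rfl h.2
    rwa [Real.sin_pi_div_two] at this
  have hodd : Tendsto (fun k : ℕ => 2 * k + 1) atTop atTop :=
    tendsto_atTop_mono (fun k => by simp only [id]; omega) tendsto_id
  have ht := (tendsto_self_mul_const_pow_of_lt_one hs0 hs1).comp hodd
  refine squeeze_zero (fun k => sineMode_nonneg ⟨h.1.le, h.2.le⟩ k) (fun k => ?_) ht
  simp only [Function.comp]
  push_cast
  exact mul_le_mul_of_nonneg_right (wallisCoeff_le k) (by positivity)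

/-- The power series of the arcsine at `sin θ`. -/
theorem hasSum_sineMode_div {θ : ℝ} (h : θ ∈ Ioo 0 (Real.pi / 2)) :
    HasSum (fun k : ℕ => sineMode k θ / (2 * k + 1) ^ 2) θ := by
  have h' : θ ∈ Icc 0 (Real.pi / 2) := ⟨h.1.le, h.2.le⟩
  rw [hasSum_iff_tendsto_nat_of_nonneg fun k => div_nonneg (sineMode_nonneg h' k) (by positivity),
    ← tendsto_add_atTop_iff_nat 1]
  have h1 : Tendsto (fun k => sineModeIntInt k θ) atTop (𝓝 0) := by
    refine squeeze_zero (sineModeIntInt_nonneg h') (sineModeIntInt_le h') ?_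
    simpa using ((tendsto_sineMode h).mul_const θ).mul_const θ
  have h2 := h1.const_sub θ
  simpa [sineModeIntInt] using h2

theorem sineModeIntInt_eq_tsum {θ : ℝ} (h : θ ∈ Ioo 0 (Real.pi / 2)) (k : ℕ) :
    ENNReal.ofReal (sineModeIntInt k θ) =
      ∑' j : ℕ, ENNReal.ofReal (1 / (2 * ((k + 1 + j : ℕ) : ℝ) + 1) ^ 2) *
        ENNReal.ofReal (sineMode (k + 1 + j) θ) := by
  have hs := hasSum_sineMode_div h
  have h' : θ ∈ Icc 0 (Real.pi / 2) := ⟨h.1.le, h.2.le⟩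
  have h1 := (hasSum_nat_add_iff' (k + 1)).mpr hs
  have h2 : sineModeIntInt k θ =
      ∑' j : ℕ, sineMode (j + (k + 1)) θ / (2 * ((j + (k + 1) : ℕ) : ℝ) + 1) ^ 2 := h1.tsum_eq.symm
  rw [h2, ENNReal.ofReal_tsum_of_nonneg _ h1.summable]
  · refine tsum_congr fun j => ?_
    rw [← ENNReal.ofReal_mul (by positivity), add_comm j, div_eq_mul_one_div, mul_comm]
  · exact fun j => div_nonneg (sineMode_nonneg h' _) (by positivity)

/-- A twofold integration turns `sineMode k` into a tail of the arcsine series. -/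
theorem primitive_primitive_sineMode (k : ℕ) {θ : ℝ} (h : θ ∈ Ioo 0 (Real.pi / 2)) :
    primitive (primitive fun θ => ENNReal.ofReal (sineMode k θ)) θ =
      ∑' j : ℕ, ENNReal.ofReal (1 / (2 * ((k + 1 + j : ℕ) : ℝ) + 1) ^ 2) *
        ENNReal.ofReal (sineMode (k + 1 + j) θ) := by
  rw [← sineModeIntInt_eq_tsum h]
  have h1 : ∀ φ ∈ Ioo 0 (Real.pi / 2), primitive (fun θ => ENNReal.ofReal (sineMode k θ)) φ =
      ENNReal.ofReal (sineModeInt k φ) := fun φ hφ =>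
    primitive_ofReal hφ.1.le (continuous_sineMode k) (hasDerivAt_sineModeInt k)
      (sineModeInt_zero k) fun ψ hψ => sineMode_nonneg ⟨hψ.1.le, hψ.2.le.trans hφ.2.le⟩ k
  rw [primitive_congr h1 h.2.le]
  exact primitive_ofReal h.1.le (continuous_sineModeInt k) (hasDerivAt_sineModeIntInt k)
    (sineModeIntInt_zero k) fun ψ hψ => sineModeInt_nonneg ⟨hψ.1.le, hψ.2.le.trans h.2.le⟩ k

/-- The integral of `f` against `(π / 2 - θ) cot θ` over `(0, π / 2)`. -/
noncomputable def cotIntegral (f : ℝ → ℝ≥0∞) : ℝ≥0∞ :=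
  ∫⁻ θ in Ioo 0 (Real.pi / 2), ENNReal.ofReal ((Real.pi / 2 - θ) * Real.cot θ) * f θ

theorem measurable_cot : Measurable Real.cot := by
  have : Real.cot = fun x => Real.cos x / Real.sin x := funext Real.cot_eq_cos_div_sin
  rw [this]
  fun_prop

theorem cotIntegral_congr {f g : ℝ → ℝ≥0∞} (h : ∀ θ ∈ Ioo 0 (Real.pi / 2), f θ = g θ) :
    cotIntegral f = cotIntegral g :=
  setLIntegral_congr_fun measurableSet_Ioo fun θ hθ => by simp only [h θ hθ]

theorem cotIntegral_tsum_mul (c : ℕ → ℝ≥0∞) {f : ℕ → ℝ → ℝ≥0∞} (hf : ∀ i, Measurable (f i)) :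
    cotIntegral (fun θ => ∑' i, c i * f i θ) = ∑' i, c i * cotIntegral (f i) := by
  have hm : Measurable fun θ => ENNReal.ofReal ((Real.pi / 2 - θ) * Real.cot θ) := by
    have := measurable_cot
    fun_prop
  unfold cotIntegral
  simp only [← ENNReal.tsum_mul_left]
  refine (lintegral_tsum fun i => (hm.mul ((hf i).const_mul (c i))).aemeasurable).trans ?_
  refine tsum_congr fun i => Eq.trans ?_ (lintegral_const_mul (c i) (hm.mul (hf i)))
  exact lintegral_congr fun θ => mul_left_comm _ _ _

theorem sin_pos_of_mem {θ : ℝ} (h : θ ∈ Ioo 0 (Real.pi / 2)) : 0 < Real.sin θ :=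
  Real.sin_pos_of_pos_of_lt_pi h.1 (by linarith [h.2, Real.pi_pos])

theorem cos_pos_of_mem {θ : ℝ} (h : θ ∈ Ioo 0 (Real.pi / 2)) : 0 < Real.cos θ :=
  Real.cos_pos_of_mem_Ioo ⟨by linarith [h.1, Real.pi_pos], h.2⟩

theorem cot_mul_sineMode {θ : ℝ} (h : θ ∈ Ioo 0 (Real.pi / 2)) (k : ℕ) :
    Real.cot θ * sineMode k θ = (2 * k + 1) * sineModeDeriv k θ := by
  have := (sin_pos_of_mem h).ne'
  have h2 : (2 * (k : ℝ) + 1) ≠ 0 := by positivity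
  rw [Real.cot_eq_cos_div_sin, sineMode, sineModeDeriv, pow_succ]
  field_simp

/-- The evaluation follows from `s_k cot θ = (2 k + 1)⁻¹ s_k'` and an integration by parts. -/
theorem cotIntegral_sineMode (k : ℕ) :
    cotIntegral (fun θ => ENNReal.ofReal (sineMode k θ)) =
      ENNReal.ofReal (1 / (2 * (k : ℝ) + 1)) := by
  have h2 : (2 * (k : ℝ) + 1) ≠ 0 := by positivity
  have hd : ∀ θ, HasDerivAt (fun θ => (2 * (k : ℝ) + 1) * ((Real.pi / 2 - θ) *
      (sineMode k θ / (2 * k + 1) ^ 2)) + 1 / (2 * k + 1) * sineModeInt k θ)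
      ((Real.pi / 2 - θ) * ((2 * k + 1) * sineModeDeriv k θ)) θ := by
    intro θ
    refine (((((hasDerivAt_id θ).const_sub (Real.pi / 2)).mul
      (hasDerivAt_sineMode_div k θ)).const_mul (2 * (k : ℝ) + 1)).add
      ((hasDerivAt_sineModeInt k θ).const_mul _)).congr_deriv ?_
    simp only [id]
    field_simp
    ring
  have hc := continuous_sineModeDeriv k
  have key := primitive_ofReal (T := Real.pi / 2) (by positivity)
    (g := fun θ => (Real.pi / 2 - θ) * ((2 * k + 1) * sineModeDeriv k θ)) (by fun_prop) hd
    (by simp [sineMode, sineModeInt_zero]) (fun θ hθ => by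
      rw [← cot_mul_sineMode hθ, Real.cot_eq_cos_div_sin]
      exact mul_nonneg (by linarith [hθ.2]) (mul_nonneg (div_pos (cos_pos_of_mem hθ)
        (sin_pos_of_mem hθ)).le (sineMode_nonneg ⟨hθ.1.le, hθ.2.le⟩ k)))
  rw [sineModeInt_pi_div_two] at key
  simp only [sub_self, zero_mul, mul_zero, zero_add, mul_one] at key
  rw [← key, primitive]
  refine setLIntegral_congr_fun measurableSet_Ioo fun θ hθ => ?_
  simp only
  rw [← cot_mul_sineMode hθ, ← mul_assoc, ENNReal.ofReal_mul' (sineMode_nonneg ⟨hθ.1.le, hθ.2.le⟩ k)]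

theorem measurable_ofReal_sineMode (k : ℕ) :
    Measurable fun θ => ENNReal.ofReal (sineMode k θ) :=
  (continuous_sineMode k).measurable.ennreal_ofReal

/-- Each twofold integration contributes one entry `2`, and the final integral against
`(π / 2 - θ) cot θ` raises the last exponent to `3`. -/
theorem cotIntegral_iterate_primitive_sineMode (m k : ℕ) :
    cotIntegral (primitive^[2 * (m + 1)] fun θ => ENNReal.ofReal (sineMode k θ)) =
      tailSum (List.replicate m 2 ++ [3]) (k + 1) := by
  have step : ∀ m k, cotIntegral (primitive^[2 * (m + 1)] fun θ => ENNReal.ofReal (sineMode k θ)) =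
      ∑' j : ℕ, ENNReal.ofReal (1 / (2 * ((k + 1 + j : ℕ) : ℝ) + 1) ^ 2) *
        cotIntegral (primitive^[2 * m] fun θ => ENNReal.ofReal (sineMode (k + 1 + j) θ)) := by
    intro m k
    rw [← cotIntegral_tsum_mul _ fun j =>
      measurable_iterate_primitive (measurable_ofReal_sineMode _) _]
    rw [← iterate_primitive_tsum_mul _ fun j => measurable_ofReal_sineMode _]
    refine cotIntegral_congr ?_
    rw [mul_add, mul_one, Function.iterate_add]
    exact iterate_primitive_congr (fun θ hθ => primitive_primitive_sineMode k hθ) _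
  induction m generalizing k with
  | zero =>
    rw [step]
    simp only [mul_zero, Function.iterate_zero, id, cotIntegral_sineMode, List.replicate_zero,
      List.nil_append, tailSum, mul_one]
    refine tsum_congr fun j => ?_
    rw [← ENNReal.ofReal_mul (by positivity), pow_succ _ 2, one_div_mul_one_div]
  | succ m ih =>
    rw [step, List.replicate_succ, List.cons_append, tailSum]
    simp only [ih]

/-- The integral representation of `t(3, {2}ⁿ, 3)` as a value in `ℝ≥0∞`. -/
theorem tailSum_string323 (n : ℕ) :
    tailSum (string323 n) 0 = ∫⁻ θ in Ioo 0 (Real.pi / 2),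
      ENNReal.ofReal ((Real.pi / 2 - θ) * Real.cot θ) * ∫⁻ φ in Ioo 0 θ,
        ENNReal.ofReal ((θ - φ) ^ (2 * n + 2) / (2 * n + 2).factorial) *
          ENNReal.ofReal (φ * Real.cot φ) := by
  have hm : Measurable fun φ => ENNReal.ofReal (φ * Real.cot φ) := by
    have := measurable_cot
    fun_prop
  simp only [← iterate_primitive_eq hm]
  change _ = cotIntegral (primitive^[2 * n + 2 + 1] _)
  have e1 : ∀ θ ∈ Ioo 0 (Real.pi / 2), primitive (fun φ => ENNReal.ofReal (φ * Real.cot φ)) θ =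
      ∑' k : ℕ, ENNReal.ofReal (1 / (2 * (k : ℝ) + 1) ^ 3) * ENNReal.ofReal (sineMode k θ) := by
    intro θ hθ
    have e2 : ∀ φ ∈ Ioo 0 (Real.pi / 2), ENNReal.ofReal (φ * Real.cot φ) =
        ∑' k : ℕ, ENNReal.ofReal (sineModeDeriv k φ / (2 * k + 1)) := by
      intro φ hφ
      have hs := (hasSum_sineMode_div hφ).mul_right (Real.cot φ)
      have hk : ∀ k : ℕ, sineMode k φ / (2 * k + 1) ^ 2 * Real.cot φ =
          sineModeDeriv k φ / (2 * k + 1) := by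
        intro k
        have h2 : (2 * (k : ℝ) + 1) ≠ 0 := by positivity
        rw [div_mul_eq_mul_div, mul_comm, cot_mul_sineMode hφ]
        field_simp
      simp only [hk] at hs
      rw [← hs.tsum_eq, ENNReal.ofReal_tsum_of_nonneg _ hs.summable]
      intro k
      rw [← hk, Real.cot_eq_cos_div_sin]
      exact mul_nonneg (div_nonneg (sineMode_nonneg ⟨hφ.1.le, hφ.2.le⟩ k) (by positivity))
        (div_pos (cos_pos_of_mem hφ) (sin_pos_of_mem hφ)).le
    rw [primitive_congr e2 hθ.2.le, primitive_tsum]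
    · refine tsum_congr fun k => ?_
      have h2 : (2 * (k : ℝ) + 1) ≠ 0 := by positivity
      have hc := continuous_sineModeDeriv k
      rw [primitive_ofReal hθ.1.le (hc.div_const _)
        (fun φ => (hasDerivAt_sineMode_div k φ).div_const _) (by simp [sineMode]),
        ← ENNReal.ofReal_mul (by positivity)]
      · congr 1
        field_simp
      · intro φ hφ
        have hφ' : φ ∈ Ioo 0 (Real.pi / 2) := ⟨hφ.1, hφ.2.trans hθ.2⟩
        have := (sin_pos_of_mem hφ').le
        have := (cos_pos_of_mem hφ').le
        have := wallisCoeff_nonneg k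
        unfold sineModeDeriv
        positivity
    · intro k
      have hc := continuous_sineModeDeriv k
      exact (hc.div_const _).measurable.ennreal_ofReal
  rw [Function.iterate_succ, Function.comp_apply,
    cotIntegral_congr (iterate_primitive_congr e1 _),
    iterate_primitive_tsum_mul _ measurable_ofReal_sineMode,
    cotIntegral_tsum_mul _ fun j => measurable_iterate_primitive (measurable_ofReal_sineMode _) _]
  change tailSum (3 :: (List.replicate n 2 ++ [3])) 0 = _
  rw [tailSum]
  refine tsum_congr fun k => ?_
  rw [zero_add, ← cotIntegral_iterate_primitive_sineMode]
  rfl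

/-! ### The integral over the triangle -/

/-- The triangle `0 < φ < θ < π / 2`, whose points are the pairs `(θ, φ)`. -/
def triangle : Set (ℝ × ℝ) := {p | 0 < p.2 ∧ p.2 < p.1 ∧ p.1 < Real.pi / 2}

/-- The density `(π / 2 - θ) cot θ · φ cot φ` on the triangle. -/
noncomputable def weight (p : ℝ × ℝ) : ℝ :=
  (Real.pi / 2 - p.1) * Real.cot p.1 * (p.2 * Real.cot p.2)

theorem measurableSet_triangle : MeasurableSet triangle :=
  (measurableSet_lt measurable_const measurable_snd).inter
    ((measurableSet_lt measurable_snd measurable_fst).inter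
      (measurableSet_lt measurable_fst measurable_const))

theorem measurable_weight : Measurable weight := by
  have := measurable_cot
  unfold weight
  fun_prop

theorem lintegral_triangle {f : ℝ × ℝ → ℝ≥0∞} (hf : Measurable f) :
    ∫⁻ p in triangle, f p =
      ∫⁻ θ in Ioo 0 (Real.pi / 2), ∫⁻ φ in Ioo 0 θ, f (θ, φ) := by
  rw [← lintegral_indicator measurableSet_triangle, Measure.volume_eq_prod,
    lintegral_prod _ (hf.indicator measurableSet_triangle).aemeasurable,
    ← lintegral_indicator measurableSet_Ioo]
  refine lintegral_congr fun θ => ?_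
  by_cases hθ : θ ∈ Ioo 0 (Real.pi / 2)
  · rw [indicator_of_mem hθ, ← lintegral_indicator measurableSet_Ioo]
    refine lintegral_congr fun φ => ?_
    have := hθ.2
    simp only [indicator, triangle, mem_ofPred_eq, mem_Ioo, this, and_true]
  · rw [indicator_of_notMem hθ]
    refine (lintegral_congr fun φ => ?_).trans lintegral_zero
    refine indicator_of_notMem (fun h => hθ ?_) _
    exact ⟨h.1.trans h.2.1, h.2.2⟩

theorem cot_pos_of_mem {θ : ℝ} (h : θ ∈ Ioo 0 (Real.pi / 2)) : 0 < Real.cot θ := by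
  rw [Real.cot_eq_cos_div_sin]
  exact div_pos (cos_pos_of_mem h) (sin_pos_of_mem h)

theorem mul_cot_le_one {θ : ℝ} (h : θ ∈ Ioo 0 (Real.pi / 2)) : θ * Real.cot θ ≤ 1 := by
  have h1 := Real.lt_tan h.1 h.2
  rw [Real.tan_eq_sin_div_cos, lt_div_iff₀ (cos_pos_of_mem h)] at h1
  rw [Real.cot_eq_cos_div_sin, mul_div_assoc', div_le_one (sin_pos_of_mem h)]
  exact h1.le

theorem fst_mem_of_mem_triangle {p : ℝ × ℝ} (h : p ∈ triangle) : p.1 ∈ Ioo 0 (Real.pi / 2) :=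
  ⟨h.1.trans h.2.1, h.2.2⟩

theorem snd_mem_of_mem_triangle {p : ℝ × ℝ} (h : p ∈ triangle) : p.2 ∈ Ioo 0 (Real.pi / 2) :=
  ⟨h.1, h.2.1.trans h.2.2⟩

theorem weight_nonneg {p : ℝ × ℝ} (h : p ∈ triangle) : 0 ≤ weight p := by
  have h1 := cot_pos_of_mem (fst_mem_of_mem_triangle h)
  have h2 := cot_pos_of_mem (snd_mem_of_mem_triangle h)
  have h3 := h.1
  have h4 : 0 < Real.pi / 2 - p.1 := by linarith [h.2.2]
  unfold weight
  positivity

/-- The density is unbounded near `(0, 0)`, but its integral over `0 < φ < θ` is at most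
`θ (π / 2 - θ) cot θ ≤ π / 2`. -/
theorem integrableOn_weight : IntegrableOn weight triangle := by
  refine ⟨measurable_weight.aestronglyMeasurable, ?_⟩
  rw [hasFiniteIntegral_iff_ofReal
    ((ae_restrict_iff' measurableSet_triangle).mpr (ae_of_all _ fun p hp => weight_nonneg hp)),
    lintegral_triangle measurable_weight.ennreal_ofReal]
  have h : ∀ θ ∈ Ioo 0 (Real.pi / 2), ∫⁻ φ in Ioo 0 θ, ENNReal.ofReal (weight (θ, φ)) ≤
      ENNReal.ofReal (Real.pi / 2) := by
    intro θ hθ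
    have h1 : ∀ φ ∈ Ioo 0 θ, ENNReal.ofReal (weight (θ, φ)) ≤
        ENNReal.ofReal ((Real.pi / 2 - θ) * Real.cot θ) := by
      intro φ hφ
      refine ENNReal.ofReal_le_ofReal (mul_le_of_le_one_right ?_ ?_)
      · exact mul_nonneg (by linarith [hθ.2]) (cot_pos_of_mem hθ).le
      · exact mul_cot_le_one ⟨hφ.1, hφ.2.trans hθ.2⟩
    refine (setLIntegral_mono measurable_const h1).trans ?_
    rw [setLIntegral_const, Real.volume_Ioo, sub_zero, ← ENNReal.ofReal_mul
      (mul_nonneg (by linarith [hθ.2]) (cot_pos_of_mem hθ).le)]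
    refine ENNReal.ofReal_le_ofReal ?_
    have := mul_cot_le_one hθ
    nlinarith [hθ.1, hθ.2, mul_pos hθ.1 (cot_pos_of_mem hθ)]
  refine (setLIntegral_mono measurable_const h).trans_lt ?_
  rw [setLIntegral_const, Real.volume_Ioo]
  exact ENNReal.mul_lt_top ENNReal.ofReal_lt_top ENNReal.ofReal_lt_top

theorem sub_mem_of_mem_triangle {p : ℝ × ℝ} (h : p ∈ triangle) :
    p.1 - p.2 ∈ Ioo 0 (Real.pi / 2) :=
  ⟨by linarith [h.2.1], by linarith [h.1, h.2.2]⟩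

theorem integrableOn_weight_mul {f : ℝ × ℝ → ℝ} (hf : Measurable f) {C : ℝ}
    (hC : ∀ p ∈ triangle, |f p| ≤ C) : IntegrableOn (fun p => weight p * f p) triangle := by
  refine Integrable.mul_bdd (c := C) integrableOn_weight hf.aestronglyMeasurable ?_
  exact (ae_restrict_iff' measurableSet_triangle).mpr (ae_of_all _ hC)

theorem integrableOn_weight_mul_pow (m : ℕ) :
    IntegrableOn (fun p => weight p * ((p.1 - p.2) ^ m / m.factorial)) triangle := by
  refine integrableOn_weight_mul (C := (Real.pi / 2) ^ m / m.factorial) (by fun_prop) ?_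
  intro p hp
  have h := sub_mem_of_mem_triangle hp
  have h0 := h.1.le
  have h1 := h.2.le
  rw [abs_of_nonneg (by positivity)]
  gcongr

/-- Tonelli's theorem: the iterated integral of `tailSum_string323` over the triangle. -/
theorem tailSum_string323_eq_ofReal (n : ℕ) :
    tailSum (string323 n) 0 = ENNReal.ofReal
      (∫ p in triangle, weight p * ((p.1 - p.2) ^ (2 * n + 2) / (2 * n + 2).factorial)) := by
  rw [ofReal_integral_eq_lintegral_ofReal (integrableOn_weight_mul_pow _),
    lintegral_triangle, tailSum_string323]
  · refine setLIntegral_congr_fun measurableSet_Ioo fun θ hθ => ?_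
    simp only
    rw [← lintegral_const_mul]
    · refine setLIntegral_congr_fun measurableSet_Ioo fun φ hφ => ?_
      have h1 : 0 ≤ (Real.pi / 2 - θ) * Real.cot θ :=
        mul_nonneg (by linarith [hθ.2]) (cot_pos_of_mem hθ).le
      have h2 : 0 ≤ (θ - φ) ^ (2 * n + 2) / (2 * n + 2).factorial := by
        have : 0 ≤ θ - φ := by linarith [hφ.2]
        positivity
      simp only [weight]
      rw [← ENNReal.ofReal_mul h2, ← ENNReal.ofReal_mul h1]
      congr 1
      ring
    · have := measurable_cot
      fun_prop
  · have := measurable_weight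
    fun_prop
  · refine (ae_restrict_iff' measurableSet_triangle).mpr (ae_of_all _ fun p hp => ?_)
    have h0 := (sub_mem_of_mem_triangle hp).1.le
    have := weight_nonneg hp
    simp only [Pi.zero_apply]
    positivity

theorem summable_tTerm_string323 (n : ℕ) : Summable (tTerm (string323 n)) :=
  summable_tTerm (by rw [tailSum_string323_eq_ofReal]; exact ENNReal.ofReal_ne_top)

theorem tValue_string323 (n : ℕ) : tValue (string323 n) =
    ∫ p in triangle, weight p * ((p.1 - p.2) ^ (2 * n + 2) / (2 * n + 2).factorial) := by
  rw [tValue_eq_toReal, tailSum_string323_eq_ofReal, ENNReal.toReal_ofReal]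
  refine setIntegral_nonneg measurableSet_triangle fun p hp => ?_
  have h0 := (sub_mem_of_mem_triangle hp).1.le
  have := weight_nonneg hp
  positivity

/-- The generating function `∑ (-1)ⁿ t(3, {2}ⁿ, 3) x ^ (2 n + 2)`, in its integral form. -/
noncomputable def generating (x : ℝ) : ℝ :=
  ∫ p in triangle, weight p * (1 - Real.cos (x * (p.1 - p.2)))

theorem hasSum_one_sub_cos (y : ℝ) :
    HasSum (fun n : ℕ => (-1) ^ n * (y ^ (2 * n + 2) / (2 * n + 2).factorial)) (1 - Real.cos y) := by
  have h := (hasSum_nat_add_iff' 1).mpr (Real.hasSum_cos y)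
  simp only [Finset.range_one, Finset.sum_singleton, pow_zero, mul_zero, Nat.factorial_zero,
    Nat.cast_one, div_one, mul_one] at h
  have h2 := h.neg
  rw [neg_sub] at h2
  refine h2.congr_fun ?_
  intro n
  rw [mul_add, mul_one, pow_succ (-1 : ℝ) n]
  ring

theorem hasSum_generating (x : ℝ) :
    HasSum (fun n : ℕ => (-1) ^ n * x ^ (2 * n + 2) * tValue (string323 n)) (generating x) := by
  have h := hasSum_integral_of_summable_integral_norm (μ := volume.restrict triangle)
    (F := fun (n : ℕ) (p : ℝ × ℝ) => (-1) ^ n * x ^ (2 * n + 2) *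
      (weight p * ((p.1 - p.2) ^ (2 * n + 2) / (2 * n + 2).factorial)))
    (fun n => (integrableOn_weight_mul_pow (2 * n + 2)).const_mul _) ?_
  · simp only [integral_const_mul, ← tValue_string323] at h
    have e : generating x = ∫ p in triangle, ∑' n : ℕ, (-1) ^ n * x ^ (2 * n + 2) *
        (weight p * ((p.1 - p.2) ^ (2 * n + 2) / (2 * n + 2).factorial)) := by
      refine setIntegral_congr_fun measurableSet_triangle fun p _ => ?_
      have h2 := (hasSum_one_sub_cos (x * (p.1 - p.2))).mul_left (weight p)
      refine h2.tsum_eq.symm.trans (tsum_congr fun n => ?_)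
      rw [mul_pow]
      ring
    rw [e]
    exact h
  · have hs : Summable fun n : ℕ => (|x| * (Real.pi / 2)) ^ (2 * n + 2) / (2 * n + 2).factorial *
        ∫ p in triangle, weight p := by
      have h1 : Function.Injective fun n : ℕ => 2 * n + 2 := fun a b h => by simpa using h
      exact ((Real.summable_pow_div_factorial (|x| * (Real.pi / 2))).comp_injective h1).mul_right _
    refine Summable.of_nonneg_of_le (fun n => integral_nonneg fun p => norm_nonneg _)
      (fun n => ?_) hs
    rw [← integral_const_mul]
    refine setIntegral_mono_on ((integrableOn_weight_mul_pow (2 * n + 2)).const_mul _).norm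
      (integrableOn_weight.const_mul _) measurableSet_triangle fun p hp => ?_
    have h := sub_mem_of_mem_triangle hp
    have h0 := h.1.le
    have h1 := h.2.le
    have hw := weight_nonneg hp
    rw [Real.norm_eq_abs, abs_mul, abs_mul, abs_pow, abs_neg, abs_one, one_pow, one_mul, abs_pow,
      abs_of_nonneg (a := weight p * _) (by positivity), mul_pow]
    calc |x| ^ (2 * n + 2) * (weight p * ((p.1 - p.2) ^ (2 * n + 2) / (2 * n + 2).factorial))
        ≤ |x| ^ (2 * n + 2) * (weight p * ((Real.pi / 2) ^ (2 * n + 2) / (2 * n + 2).factorial)) := by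
          gcongr
      _ = _ := by ring

/-- The Riemann–Lebesgue lemma, for real integrands and along a ray of linear forms. -/
theorem tendsto_integral_mul_cos_sin {V : Type*} [NormedAddCommGroup V] [NormedSpace ℝ V]
    [FiniteDimensional ℝ V] [MeasurableSpace V] [BorelSpace V] {μ : Measure V}
    [μ.IsAddHaarMeasure] {f : V → ℝ} (hf : Integrable f μ) {w : StrongDual ℝ V} (hw : w ≠ 0) :
    Tendsto (fun x : ℝ => ∫ v, f v * Real.cos (x * w v) ∂μ) atTop (𝓝 0) ∧
      Tendsto (fun x : ℝ => ∫ v, f v * Real.sin (x * w v) ∂μ) atTop (𝓝 0) := by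
  -- The additive character of Mathlib is `t ↦ exp (2 π i t)`, whence the scaling of the linear form.
  have h1 : Tendsto (fun x : ℝ => -(x / (2 * Real.pi)) • w) atTop (cocompact (StrongDual ℝ V)) := by
    refine tendsto_cocompact_of_tendsto_dist_comp_atTop 0 ?_
    simp only [dist_zero_right, norm_smul, norm_neg]
    refine Tendsto.atTop_mul_const (norm_pos_iff.mpr hw) ?_
    exact tendsto_norm_atTop_atTop.comp (tendsto_id.atTop_div_const (by positivity))
  have h2 := (tendsto_integral_exp_smul_cocompact (fun v => (f v : ℂ)) μ).comp h1
  have e : ∀ (x : ℝ) (v : V), Real.fourierChar (-(-(x / (2 * Real.pi)) • w) v) • (f v : ℂ) =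
      (f v : ℂ) * Complex.exp ((x * w v : ℝ) * Complex.I) := by
    intro x v
    rw [Circle.smul_def, smul_eq_mul, mul_comm, Real.fourierChar_apply]
    congr 3
    have := Real.pi_ne_zero
    simp only [smul_apply, smul_eq_mul]
    congr 1
    field_simp
  have hi : ∀ x : ℝ, Integrable (fun v => (f v : ℂ) *
      Complex.exp ((x * w v : ℝ) * Complex.I)) μ := by
    intro x
    refine Integrable.mul_bdd (c := 1) hf.ofReal ?_ ?_
    · exact Continuous.aestronglyMeasurable (by fun_prop)
    · exact ae_of_all _ fun p => by rw [Complex.norm_exp_ofReal_mul_I]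
  have hre : ∀ x : ℝ, ∫ v, f v * Real.cos (x * w v) ∂μ =
      (∫ v, (f v : ℂ) * Complex.exp ((x * w v : ℝ) * Complex.I) ∂μ).re := by
    intro x
    rw [← RCLike.re_eq_complex_re, ← integral_re (hi x)]
    refine integral_congr_ae (ae_of_all _ fun v => ?_)
    simp only [RCLike.re_eq_complex_re, Complex.re_ofReal_mul, Complex.exp_ofReal_mul_I_re]
  have him : ∀ x : ℝ, ∫ v, f v * Real.sin (x * w v) ∂μ =
      (∫ v, (f v : ℂ) * Complex.exp ((x * w v : ℝ) * Complex.I) ∂μ).im := by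
    intro x
    rw [← RCLike.im_eq_complex_im, ← integral_im (hi x)]
    refine integral_congr_ae (ae_of_all _ fun v => ?_)
    simp only [RCLike.im_eq_complex_im, Complex.im_ofReal_mul, Complex.exp_ofReal_mul_I_im]
  simp only [Function.comp_def, e] at h2
  simp only [hre, him]
  exact ⟨(Complex.continuous_re.tendsto _).comp h2, (Complex.continuous_im.tendsto _).comp h2⟩

theorem integrableOn_weight_mul_one_sub_cos (x : ℝ) :
    IntegrableOn (fun p => weight p * (1 - Real.cos (x * (p.1 - p.2)))) triangle := by
  refine integrableOn_weight_mul (C := 2) (by fun_prop) fun p _ => ?_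
  have h1 := Real.cos_le_one (x * (p.1 - p.2))
  have h2 := Real.neg_one_le_cos (x * (p.1 - p.2))
  rw [abs_of_nonneg] <;> linarith

theorem tendsto_generating :
    Tendsto generating atTop (𝓝 (∫ p in triangle, weight p)) := by
  have hw : ContinuousLinearMap.fst ℝ ℝ ℝ - ContinuousLinearMap.snd ℝ ℝ ℝ ≠ 0 := by
    intro h
    have := congrArg (fun f => f (1, 0)) h
    simp at this
  have h := (tendsto_integral_mul_cos_sin
    ((integrable_indicator_iff measurableSet_triangle).mpr integrableOn_weight) hw).1
  have e : ∀ x : ℝ, generating x = (∫ p in triangle, weight p) -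
      ∫ p, triangle.indicator weight p *
        Real.cos (x * (ContinuousLinearMap.fst ℝ ℝ ℝ - ContinuousLinearMap.snd ℝ ℝ ℝ) p) := by
    intro x
    have e2 : ∀ p : ℝ × ℝ, triangle.indicator weight p *
        Real.cos (x * (ContinuousLinearMap.fst ℝ ℝ ℝ - ContinuousLinearMap.snd ℝ ℝ ℝ) p) =
        triangle.indicator (fun p => weight p * Real.cos (x * (p.1 - p.2))) p := by
      intro p
      by_cases hp : p ∈ triangle
      · rw [indicator_of_mem hp, indicator_of_mem hp]
        rfl
      · rw [indicator_of_notMem hp, indicator_of_notMem hp, zero_mul]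
    simp only [e2]
    rw [integral_indicator measurableSet_triangle, generating, ← integral_sub integrableOn_weight]
    · refine integral_congr_ae (ae_of_all _ fun p => ?_)
      simp only
      ring
    · exact integrableOn_weight_mul (by fun_prop) fun p _ => Real.abs_cos_le_one _
  rw [funext e]
  simpa using h.const_sub (∫ p in triangle, weight p)

/-! ### A difference equation for the generating function -/

theorem integral_triangle {F : ℝ × ℝ → ℝ} (hF : IntegrableOn F triangle) :
    ∫ p in triangle, F p = ∫ θ in (0 : ℝ)..Real.pi / 2, ∫ φ in (0 : ℝ)..θ, F (θ, φ) := by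
  rw [← integral_indicator measurableSet_triangle, Measure.volume_eq_prod, integral_prod _
    ((integrable_indicator_iff measurableSet_triangle).mpr hF),
    intervalIntegral.integral_of_le (by positivity), integral_Ioc_eq_integral_Ioo,
    ← integral_indicator measurableSet_Ioo]
  refine integral_congr_ae (ae_of_all _ fun θ => ?_)
  by_cases hθ : θ ∈ Ioo 0 (Real.pi / 2)
  · simp only [indicator_of_mem hθ]
    rw [intervalIntegral.integral_of_le hθ.1.le, integral_Ioc_eq_integral_Ioo,
      ← integral_indicator measurableSet_Ioo]
    refine integral_congr_ae (ae_of_all _ fun φ => ?_)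
    have := hθ.2
    simp only [indicator, triangle, mem_ofPred_eq, mem_Ioo, this, and_true]
  · simp only [indicator_of_notMem hθ]
    refine (integral_congr_ae (ae_of_all _ fun φ => ?_)).trans (integral_zero _ _)
    refine indicator_of_notMem (fun h => hθ ?_) _
    exact ⟨h.1.trans h.2.1, h.2.2⟩

theorem integral_triangle_symm {F : ℝ × ℝ → ℝ} (hF : IntegrableOn F triangle) :
    ∫ p in triangle, F p =
      ∫ φ in (0 : ℝ)..Real.pi / 2, ∫ θ in φ..Real.pi / 2, F (θ, φ) := by
  rw [← integral_indicator measurableSet_triangle, Measure.volume_eq_prod, integral_prod_symm _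
    ((integrable_indicator_iff measurableSet_triangle).mpr hF),
    intervalIntegral.integral_of_le (by positivity), integral_Ioc_eq_integral_Ioo,
    ← integral_indicator measurableSet_Ioo]
  refine integral_congr_ae (ae_of_all _ fun φ => ?_)
  by_cases hφ : φ ∈ Ioo 0 (Real.pi / 2)
  · simp only [indicator_of_mem hφ]
    rw [intervalIntegral.integral_of_le hφ.2.le, integral_Ioc_eq_integral_Ioo,
      ← integral_indicator measurableSet_Ioo]
    refine integral_congr_ae (ae_of_all _ fun θ => ?_)
    have := hφ.1
    simp only [indicator, triangle, mem_ofPred_eq, mem_Ioo, this, true_and]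
  · simp only [indicator_of_notMem hφ]
    refine (integral_congr_ae (ae_of_all _ fun θ => ?_)).trans (integral_zero _ _)
    refine indicator_of_notMem (fun h => hφ ?_) _
    exact ⟨h.1, h.2.1.trans h.2.2⟩

theorem volume_triangle_lt_top : volume triangle < ∞ := by
  have h : triangle ⊆ Ioo 0 (Real.pi / 2) ×ˢ Ioo 0 (Real.pi / 2) := fun p hp =>
    ⟨fst_mem_of_mem_triangle hp, snd_mem_of_mem_triangle hp⟩
  refine (measure_mono h).trans_lt ?_
  rw [Measure.volume_eq_prod, Measure.prod_prod, Real.volume_Ioo]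
  exact ENNReal.mul_lt_top ENNReal.ofReal_lt_top ENNReal.ofReal_lt_top

theorem integrableOn_triangle {F : ℝ × ℝ → ℝ} (hF : Measurable F) (C : ℝ)
    (hC : ∀ p ∈ triangle, |F p| ≤ C) : IntegrableOn F triangle :=
  Measure.integrableOn_of_bounded (M := C) volume_triangle_lt_top.ne hF.aestronglyMeasurable
    ((ae_restrict_iff' measurableSet_triangle).mpr (ae_of_all _ hC))

theorem intervalIntegrable_of_bound {f : ℝ → ℝ} (hf : Measurable f) (C : ℝ)
    (hC : ∀ θ ∈ Ioo 0 (Real.pi / 2), |f θ| ≤ C) :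
    IntervalIntegrable f volume 0 (Real.pi / 2) := by
  rw [intervalIntegrable_iff_integrableOn_Ioo_of_le (by positivity)]
  exact Measure.integrableOn_of_bounded (M := C) (by simp) hf.aestronglyMeasurable
    ((ae_restrict_iff' measurableSet_Ioo).mpr (ae_of_all _ hC))

theorem measurable_tan : Measurable Real.tan := by
  have : Real.tan = fun x => Real.sin x / Real.cos x := funext Real.tan_eq_sin_div_cos
  rw [this]
  fun_prop

theorem cot_pi_div_two_sub (θ : ℝ) : Real.cot (Real.pi / 2 - θ) = Real.tan θ := by
  rw [Real.cot_eq_cos_div_sin, Real.cos_pi_div_two_sub, Real.sin_pi_div_two_sub,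
    Real.tan_eq_sin_div_cos]

theorem tan_pi_div_two_sub (θ : ℝ) : Real.tan (Real.pi / 2 - θ) = Real.cot θ := by
  rw [← cot_pi_div_two_sub, sub_sub_cancel]

theorem pi_div_two_sub_mem {θ : ℝ} (h : θ ∈ Ioo 0 (Real.pi / 2)) :
    Real.pi / 2 - θ ∈ Ioo 0 (Real.pi / 2) :=
  ⟨by linarith [h.2], by linarith [h.1]⟩

theorem abs_mul_cot_le {θ : ℝ} (h : θ ∈ Ioo 0 (Real.pi / 2)) : |θ * Real.cot θ| ≤ 1 := by
  rw [abs_of_pos (mul_pos h.1 (cot_pos_of_mem h))]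
  exact mul_cot_le_one h

theorem abs_sub_mul_tan_le {θ : ℝ} (h : θ ∈ Ioo 0 (Real.pi / 2)) :
    |(Real.pi / 2 - θ) * Real.tan θ| ≤ 1 := by
  rw [← cot_pi_div_two_sub]
  exact abs_mul_cot_le (pi_div_two_sub_mem h)

theorem abs_le_of_mem {θ : ℝ} (h : θ ∈ Ioo 0 (Real.pi / 2)) : |θ| ≤ Real.pi / 2 := by
  rw [abs_of_pos h.1]
  exact h.2.le

theorem abs_sin_mul_cot_le (y : ℝ) {θ : ℝ} (h : θ ∈ Ioo 0 (Real.pi / 2)) :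
    |Real.cot θ * Real.sin (y * θ)| ≤ |y| := by
  have h1 : |Real.sin (y * θ)| ≤ |y * θ| := Real.abs_sin_le_abs
  calc |Real.cot θ * Real.sin (y * θ)| ≤ |Real.cot θ| * |y * θ| := by
        rw [abs_mul]; gcongr
    _ = |y| * |θ * Real.cot θ| := by rw [abs_mul, abs_mul]; ring
    _ ≤ |y| * 1 := by gcongr; exact abs_mul_cot_le h
    _ = |y| := mul_one _

theorem intervalIntegrable_tan_mul {f : ℝ → ℝ} (hf : Continuous f) :
    IntervalIntegrable (fun θ => (Real.pi / 2 - θ) * Real.tan θ * f θ) volume 0 (Real.pi / 2) := by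
  have h : IntervalIntegrable (fun θ => (Real.pi / 2 - θ) * Real.tan θ) volume 0 (Real.pi / 2) :=
    intervalIntegrable_of_bound (by have := measurable_tan; fun_prop) 1
      fun θ hθ => abs_sub_mul_tan_le hθ
  exact h.mul_continuousOn hf.continuousOn

theorem intervalIntegrable_cot_mul_sin (y : ℝ) {f : ℝ → ℝ} (hf : Continuous f) :
    IntervalIntegrable (fun θ => f θ * (Real.cot θ * Real.sin (y * θ))) volume 0
      (Real.pi / 2) := by
  have h : IntervalIntegrable (fun θ => Real.cot θ * Real.sin (y * θ)) volume 0 (Real.pi / 2) :=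
    intervalIntegrable_of_bound (by have := measurable_cot; fun_prop) |y|
      fun θ hθ => abs_sin_mul_cot_le y hθ
  exact h.continuousOn_mul hf.continuousOn

theorem intervalIntegrable_mul_cot {f : ℝ → ℝ} (hf : Continuous f) :
    IntervalIntegrable (fun θ => f θ * (θ * Real.cot θ)) volume 0 (Real.pi / 2) := by
  have h : IntervalIntegrable (fun θ => θ * Real.cot θ) volume 0 (Real.pi / 2) :=
    intervalIntegrable_of_bound (by have := measurable_cot; fun_prop) 1
      fun θ hθ => abs_mul_cot_le hθ
  exact h.continuousOn_mul hf.continuousOn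

/-- The sine transform of `(π / 2 - θ) (cot θ - tan θ)`. -/
noncomputable def cotTransform (y : ℝ) : ℝ :=
  ∫ θ in (0 : ℝ)..Real.pi / 2,
    (Real.pi / 2 - θ) * (Real.cot θ - Real.tan θ) * Real.sin (y * θ)

theorem integral_sub_mul_sin {y : ℝ} (hy : y ≠ 0) (φ T : ℝ) :
    ∫ θ in φ..T, (T - θ) * Real.sin (y * (θ - φ)) =
      (T - φ) / y - Real.sin (y * (T - φ)) / y ^ 2 := by
  have hd : ∀ θ ∈ uIcc φ T, HasDerivAt (fun θ => -((T - θ) * Real.cos (y * (θ - φ)) / y) -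
      Real.sin (y * (θ - φ)) / y ^ 2) ((T - θ) * Real.sin (y * (θ - φ))) θ := by
    intro θ _
    have h1 : HasDerivAt (fun θ => y * (θ - φ)) (y * 1) θ :=
      ((hasDerivAt_id θ).sub_const φ).const_mul y
    have h2 : HasDerivAt (fun θ => T - θ) (-1) θ := (hasDerivAt_id θ).const_sub T
    refine ((((h2.mul h1.cos).div_const y).neg).sub (h1.sin.div_const (y ^ 2))).congr_deriv ?_
    field_simp
    ring
  rw [intervalIntegral.integral_eq_sub_of_hasDerivAt hd
    ((by fun_prop : Continuous _).intervalIntegrable _ _)]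
  simp
  ring

theorem integral_mul_sin_sub {y : ℝ} (hy : y ≠ 0) (θ : ℝ) :
    ∫ φ in (0 : ℝ)..θ, φ * Real.sin (y * (θ - φ)) = θ / y - Real.sin (y * θ) / y ^ 2 := by
  have h := integral_sub_mul_sin hy 0 θ
  have h2 := intervalIntegral.integral_comp_sub_left (a := 0) (b := θ)
    (fun φ => φ * Real.sin (y * (θ - φ))) θ
  simp only [sub_sub_cancel, sub_self, sub_zero] at h h2
  rw [← h2, h]

theorem integral_sub_mul_cos {y : ℝ} (hy : y ≠ 0) (φ T : ℝ) :
    ∫ θ in φ..T, (T - θ) * Real.cos (y * (θ - φ)) = (1 - Real.cos (y * (T - φ))) / y ^ 2 := by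
  have hd : ∀ θ ∈ uIcc φ T, HasDerivAt (fun θ => (T - θ) * Real.sin (y * (θ - φ)) / y -
      Real.cos (y * (θ - φ)) / y ^ 2) ((T - θ) * Real.cos (y * (θ - φ))) θ := by
    intro θ _
    have h1 : HasDerivAt (fun θ => y * (θ - φ)) (y * 1) θ :=
      ((hasDerivAt_id θ).sub_const φ).const_mul y
    have h2 : HasDerivAt (fun θ => T - θ) (-1) θ := (hasDerivAt_id θ).const_sub T
    refine (((h2.mul h1.sin).div_const y).sub (h1.cos.div_const (y ^ 2))).congr_deriv ?_
    field_simp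
    ring
  rw [intervalIntegral.integral_eq_sub_of_hasDerivAt hd
    ((by fun_prop : Continuous _).intervalIntegrable _ _)]
  simp
  ring

theorem integral_mul_one_sub_cos {y : ℝ} (hy : y ≠ 0) (T : ℝ) :
    ∫ φ in (0 : ℝ)..T, φ * ((1 - Real.cos (y * (T - φ))) / y ^ 2) =
      (T ^ 2 / 2 - (1 - Real.cos (y * T)) / y ^ 2) / y ^ 2 := by
  have hd : ∀ φ ∈ uIcc 0 T, HasDerivAt (fun φ => (φ ^ 2 / 2 + φ * Real.sin (y * (T - φ)) / y -
      Real.cos (y * (T - φ)) / y ^ 2) / y ^ 2) (φ * ((1 - Real.cos (y * (T - φ))) / y ^ 2)) φ := by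
    intro φ _
    have h1 : HasDerivAt (fun φ => y * (T - φ)) (y * (-1)) φ :=
      ((hasDerivAt_id φ).const_sub T).const_mul y
    have h2 := hasDerivAt_id φ
    refine ((((h2.pow 2).div_const 2).add ((h2.mul h1.sin).div_const y)).sub
      (h1.cos.div_const (y ^ 2))).div_const (y ^ 2) |>.congr_deriv ?_
    simp only [id]
    field_simp
    ring
  rw [intervalIntegral.integral_eq_sub_of_hasDerivAt hd
    ((by fun_prop : Continuous _).intervalIntegrable _ _)]
  simp
  ring

theorem integrableOn_cot_snd (y : ℝ) : IntegrableOn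
    (fun p : ℝ × ℝ => p.2 * Real.cot p.2 * ((Real.pi / 2 - p.1) * Real.sin (y * (p.1 - p.2))))
    triangle := by
  refine integrableOn_triangle (by have := measurable_cot; fun_prop) (1 * (Real.pi / 2 * 1)) ?_
  intro p hp
  rw [abs_mul]
  gcongr
  · exact abs_mul_cot_le (snd_mem_of_mem_triangle hp)
  · rw [abs_mul]
    gcongr
    · exact abs_le_of_mem (pi_div_two_sub_mem (fst_mem_of_mem_triangle hp))
    · exact Real.abs_sin_le_one _

theorem integrableOn_cot_fst (y : ℝ) : IntegrableOn
    (fun p : ℝ × ℝ => (Real.pi / 2 - p.1) * Real.cot p.1 * (p.2 * Real.sin (y * (p.1 - p.2))))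
    triangle := by
  refine integrableOn_triangle (by have := measurable_cot; fun_prop) (Real.pi / 2 * (1 * 1)) ?_
  intro p hp
  have h1 := fst_mem_of_mem_triangle hp
  have h2 : p.2 * Real.cot p.1 ≤ 1 :=
    (mul_le_mul_of_nonneg_right hp.2.1.le (cot_pos_of_mem h1).le).trans (mul_cot_le_one h1)
  have h3 : |p.2 * Real.cot p.1| ≤ 1 := by
    rwa [abs_of_pos (mul_pos hp.1 (cot_pos_of_mem h1))]
  calc |(Real.pi / 2 - p.1) * Real.cot p.1 * (p.2 * Real.sin (y * (p.1 - p.2)))|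
      = |Real.pi / 2 - p.1| * (|p.2 * Real.cot p.1| * |Real.sin (y * (p.1 - p.2))|) := by
        rw [← abs_mul, ← abs_mul]; ring_nf
    _ ≤ Real.pi / 2 * (1 * 1) := by
        gcongr
        · exact abs_le_of_mem (pi_div_two_sub_mem h1)
        · exact Real.abs_sin_le_one _

theorem integrableOn_cos (y : ℝ) : IntegrableOn
    (fun p : ℝ × ℝ => p.2 * ((Real.pi / 2 - p.1) * Real.cos (y * (p.1 - p.2)))) triangle := by
  refine integrableOn_triangle (by fun_prop) (Real.pi / 2 * (Real.pi / 2 * 1)) ?_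
  intro p hp
  rw [abs_mul, abs_mul]
  gcongr
  · exact abs_le_of_mem (snd_mem_of_mem_triangle hp)
  · exact abs_le_of_mem (pi_div_two_sub_mem (fst_mem_of_mem_triangle hp))
  · exact Real.abs_cos_le_one _

/-- The integrand is odd about `π / 4`. -/
theorem integral_mul_cot_sub_tan :
    ∫ θ in (0 : ℝ)..Real.pi / 2, (Real.pi / 2 - θ) * (Real.tan θ - Real.cot θ) * θ = 0 := by
  have h := intervalIntegral.integral_comp_sub_left (a := 0) (b := Real.pi / 2)
    (fun θ => (Real.pi / 2 - θ) * (Real.tan θ - Real.cot θ) * θ) (Real.pi / 2)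
  simp only [sub_sub_cancel, tan_pi_div_two_sub, cot_pi_div_two_sub, sub_self, sub_zero] at h
  have h2 : ∫ θ in (0 : ℝ)..Real.pi / 2, θ * (Real.cot θ - Real.tan θ) * (Real.pi / 2 - θ) =
      -∫ θ in (0 : ℝ)..Real.pi / 2, (Real.pi / 2 - θ) * (Real.tan θ - Real.cot θ) * θ := by
    rw [← intervalIntegral.integral_neg]
    exact intervalIntegral.integral_congr fun θ _ => by ring
  linarith

/-- Both sides reduce to one-dimensional integrals; the reflection `θ ↦ π / 2 - θ` turns the
cotangent of the first one into a tangent. -/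
theorem integral_cot_snd_sub_cot_fst {y : ℝ} (hy : y ≠ 0) :
    (∫ p in triangle, p.2 * Real.cot p.2 * ((Real.pi / 2 - p.1) * Real.sin (y * (p.1 - p.2)))) -
      ∫ p in triangle, (Real.pi / 2 - p.1) * Real.cot p.1 * (p.2 * Real.sin (y * (p.1 - p.2))) =
    cotTransform y / y ^ 2 := by
  rw [integral_triangle_symm (integrableOn_cot_snd y), integral_triangle (integrableOn_cot_fst y)]
  simp only [intervalIntegral.integral_const_mul, integral_sub_mul_sin hy, integral_mul_sin_sub hy]
  have h := intervalIntegral.integral_comp_sub_left (a := 0) (b := Real.pi / 2)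
    (fun θ => θ * Real.cot θ * ((Real.pi / 2 - θ) / y - Real.sin (y * (Real.pi / 2 - θ)) / y ^ 2))
    (Real.pi / 2)
  simp only [sub_sub_cancel, cot_pi_div_two_sub, sub_self, sub_zero] at h
  rw [← h]
  have i1 := intervalIntegrable_tan_mul (f := fun θ => θ / y - Real.sin (y * θ) / y ^ 2)
    (by fun_prop)
  have i2 := intervalIntegrable_cot_mul_sin y (f := fun θ => (Real.pi / 2 - θ) / y ^ 2)
    (by fun_prop)
  have i3 := intervalIntegrable_mul_cot (f := fun θ => (Real.pi / 2 - θ) / y) (by fun_prop)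
  have i4 := intervalIntegrable_tan_mul (f := fun θ => θ) (by fun_prop)
  have i5 := intervalIntegrable_mul_cot (f := fun θ => (Real.pi / 2 - θ)) (by fun_prop)
  have i6 := intervalIntegrable_tan_mul (f := fun θ => Real.sin (y * θ)) (by fun_prop)
  have i7 := intervalIntegrable_cot_mul_sin y (f := fun θ => (Real.pi / 2 - θ)) (by fun_prop)
  have e1 : ∀ θ : ℝ, (Real.pi / 2 - θ) * Real.cot θ * (θ / y - Real.sin (y * θ) / y ^ 2) =
      (Real.pi / 2 - θ) / y * (θ * Real.cot θ) -
        (Real.pi / 2 - θ) / y ^ 2 * (Real.cot θ * Real.sin (y * θ)) := fun θ => by ring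
  have e2 : ∀ θ : ℝ, (Real.pi / 2 - θ) * Real.tan θ * (θ / y - Real.sin (y * θ) / y ^ 2) -
      ((Real.pi / 2 - θ) / y * (θ * Real.cot θ) -
        (Real.pi / 2 - θ) / y ^ 2 * (Real.cot θ * Real.sin (y * θ))) =
      1 / y * ((Real.pi / 2 - θ) * (Real.tan θ - Real.cot θ) * θ) + 1 / y ^ 2 *
        ((Real.pi / 2 - θ) * (Real.cot θ - Real.tan θ) * Real.sin (y * θ)) := fun θ => by ring
  simp only [e1]
  rw [← intervalIntegral.integral_sub i1 (i3.sub i2)]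
  simp only [e2]
  rw [intervalIntegral.integral_add, intervalIntegral.integral_const_mul,
    intervalIntegral.integral_const_mul, integral_mul_cot_sub_tan, cotTransform]
  · ring
  · refine ((i4.sub i5).const_mul (1 / y)).congr fun θ _ => ?_
    ring
  · refine ((i7.sub i6).const_mul (1 / y ^ 2)).congr fun θ _ => ?_
    ring

/-- The cosine transform of `L ^ 3 / 6` in closed form, where `L = π / 2 - β`; here `L ^ 3 / 6` is the
integral of `φ (π / 2 - θ)` along the segment `θ - φ = β` of the triangle. -/
noncomputable def cubicTransform (y : ℝ) : ℝ :=
  ((Real.pi / 2) ^ 2 / 2 - (1 - Real.cos (y * (Real.pi / 2))) / y ^ 2) / y ^ 2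

theorem integral_triangle_cos {y : ℝ} (hy : y ≠ 0) :
    ∫ p in triangle, p.2 * ((Real.pi / 2 - p.1) * Real.cos (y * (p.1 - p.2))) =
      cubicTransform y := by
  rw [integral_triangle_symm (integrableOn_cos y)]
  simp only [intervalIntegral.integral_const_mul, integral_sub_mul_cos hy]
  exact integral_mul_one_sub_cos hy _

/-- The identity `sin (θ - φ) cot θ cot φ = cos (θ - φ) (cot φ - cot θ) - sin (θ - φ)`, multiplied by
`2 sin ((x + 1) (θ - φ)) φ (π / 2 - θ)`: the terms on the right contain only one cotangent each. -/
theorem weight_mul_cos_sub_cos {p : ℝ × ℝ} (hp : p ∈ triangle) (x : ℝ) :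
    weight p * (Real.cos (x * (p.1 - p.2)) - Real.cos ((x + 2) * (p.1 - p.2))) =
      (p.2 * Real.cot p.2 * ((Real.pi / 2 - p.1) * Real.sin ((x + 2) * (p.1 - p.2))) -
        (Real.pi / 2 - p.1) * Real.cot p.1 * (p.2 * Real.sin ((x + 2) * (p.1 - p.2)))) +
      (p.2 * Real.cot p.2 * ((Real.pi / 2 - p.1) * Real.sin (x * (p.1 - p.2))) -
        (Real.pi / 2 - p.1) * Real.cot p.1 * (p.2 * Real.sin (x * (p.1 - p.2)))) +
      (p.2 * ((Real.pi / 2 - p.1) * Real.cos ((x + 2) * (p.1 - p.2))) -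
        p.2 * ((Real.pi / 2 - p.1) * Real.cos (x * (p.1 - p.2)))) := by
  have hs1 := (sin_pos_of_mem (fst_mem_of_mem_triangle hp)).ne'
  have hs2 := (sin_pos_of_mem (snd_mem_of_mem_triangle hp)).ne'
  obtain ⟨θ, φ⟩ := p
  simp only at hs1 hs2 ⊢
  set b := (x + 1) * (θ - φ) with hb
  have e1 : x * (θ - φ) = b - (θ - φ) := by rw [hb]; ring
  have e2 : (x + 2) * (θ - φ) = b + (θ - φ) := by rw [hb]; ring
  rw [e1, e2, Real.cos_sub b, Real.cos_add b, Real.sin_add b, Real.sin_sub b, Real.sin_sub θ,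
    Real.cos_sub θ, weight]
  simp only [Real.cot_eq_cos_div_sin]
  field_simp
  ring

theorem generating_add_two {x : ℝ} (hx : x ≠ 0) (hx2 : x + 2 ≠ 0) :
    generating (x + 2) - generating x =
      cotTransform (x + 2) / (x + 2) ^ 2 + cotTransform x / x ^ 2 +
        (cubicTransform (x + 2) - cubicTransform x) := by
  have hg := integrableOn_weight_mul_one_sub_cos
  rw [generating, generating, ← integral_sub (hg _) (hg _),
    ← integral_cot_snd_sub_cot_fst hx, ← integral_cot_snd_sub_cot_fst hx2,
    ← integral_triangle_cos hx, ← integral_triangle_cos hx2]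
  have i1 := integrableOn_cot_snd
  have i2 := integrableOn_cot_fst
  have i3 := integrableOn_cos
  have j1 : ∀ y : ℝ, IntegrableOn (fun p : ℝ × ℝ =>
      p.2 * Real.cot p.2 * ((Real.pi / 2 - p.1) * Real.sin (y * (p.1 - p.2))) -
        (Real.pi / 2 - p.1) * Real.cot p.1 * (p.2 * Real.sin (y * (p.1 - p.2)))) triangle :=
    fun y => (i1 y).sub (i2 y)
  have j2 : IntegrableOn (fun p : ℝ × ℝ =>
      p.2 * ((Real.pi / 2 - p.1) * Real.cos ((x + 2) * (p.1 - p.2))) -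
        p.2 * ((Real.pi / 2 - p.1) * Real.cos (x * (p.1 - p.2)))) triangle :=
    (i3 _).sub (i3 _)
  rw [← integral_sub (i1 _) (i2 _), ← integral_sub (i1 _) (i2 _), ← integral_sub (i3 _) (i3 _),
    ← integral_add (j1 _) (j1 _), ← integral_add ?_ j2]
  rotate_left
  · exact (j1 (x + 2)).add (j1 x)
  refine setIntegral_congr_fun measurableSet_triangle fun p hp => ?_
  refine Eq.trans ?_ (weight_mul_cos_sub_cos hp x)
  ring

/-! ### Trigamma sums -/

/-- The sum `∑ 1 / (z + 2 k) ^ 2` over `k ≥ 0`, a trigamma value up to scaling. -/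
noncomputable def trigammaSum (z : ℝ) : ℝ := ∑' k : ℕ, 1 / (z + 2 * k) ^ 2

theorem summable_trigammaSum (z : ℝ) : Summable fun k : ℕ => 1 / (z + 2 * (k : ℝ)) ^ 2 := by
  have h := ((Real.summable_one_div_nat_add_rpow (z / 2) 2).mpr one_lt_two).mul_left (1 / 4)
  refine h.congr fun k => ?_
  rw [Real.rpow_two, sq_abs, one_div_mul_one_div]
  congr 1
  ring

theorem trigammaSum_eq_add (z : ℝ) : trigammaSum z = 1 / z ^ 2 + trigammaSum (z + 2) := by
  rw [trigammaSum, (summable_trigammaSum z).tsum_eq_zero_add, trigammaSum]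
  simp only [Nat.cast_zero, mul_zero, add_zero]
  congr 1
  refine tsum_congr fun k => ?_
  push_cast
  ring_nf

theorem tendsto_trigammaSum (z : ℝ) :
    Tendsto (fun m : ℕ => trigammaSum (z + 4 * m)) atTop (𝓝 0) := by
  have h := tendsto_sum_nat_add fun k : ℕ => 1 / (z + 2 * (k : ℝ)) ^ 2
  have h2 : Tendsto (fun m : ℕ => 2 * m) atTop atTop :=
    tendsto_atTop_mono (fun k => by simp only [id]; omega) tendsto_id
  refine (h.comp h2).congr fun m => ?_
  simp only [Function.comp, trigammaSum]
  refine tsum_congr fun k => ?_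
  push_cast
  ring_nf

theorem tendsto_integral_mul_cos_sin_interval {f : ℝ → ℝ}
    (hf : IntervalIntegrable f volume 0 (Real.pi / 2)) :
    Tendsto (fun N : ℕ => ∫ θ in (0 : ℝ)..Real.pi / 2, f θ * Real.cos ((4 * N + 2) * θ))
        atTop (𝓝 0) ∧
      Tendsto (fun N : ℕ => ∫ θ in (0 : ℝ)..Real.pi / 2, f θ * Real.sin ((4 * N + 2) * θ))
        atTop (𝓝 0) := by
  rw [intervalIntegrable_iff_integrableOn_Ioc_of_le (by positivity)] at hf
  have h := tendsto_integral_mul_cos_sin ((integrable_indicator_iff measurableSet_Ioc).mpr hf)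
    (w := ContinuousLinearMap.id ℝ ℝ) (fun h => by
      have := congrArg (fun f => f 1) h
      simp at this)
  have hN : Tendsto (fun N : ℕ => 4 * (N : ℝ) + 2) atTop atTop :=
    tendsto_atTop_add_const_right _ _
      (tendsto_natCast_atTop_atTop.const_mul_atTop (by norm_num))
  constructor
  · refine (h.1.comp hN).congr fun N => ?_
    simp only [Function.comp, ContinuousLinearMap.id_apply]
    rw [intervalIntegral.integral_of_le (by positivity), ← integral_indicator measurableSet_Ioc]
    simp only [indicator_mul_left]
  · refine (h.2.comp hN).congr fun N => ?_
    simp only [Function.comp, ContinuousLinearMap.id_apply]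
    rw [intervalIntegral.integral_of_le (by positivity), ← integral_indicator measurableSet_Ioc]
    simp only [indicator_mul_left]

/-- The conjugate Dirichlet kernel. -/
theorem sum_sin_eq {θ : ℝ} (h : θ ∈ Ioo 0 (Real.pi / 2)) (N : ℕ) :
    ∑ k ∈ Finset.range N, 4 * Real.sin (4 * (k + 1) * θ) =
      (Real.cot θ - Real.tan θ) -
        (Real.cot θ + Real.tan θ) * Real.cos ((4 * N + 2) * θ) := by
  have hs := (sin_pos_of_mem h).ne'
  have hc := (cos_pos_of_mem h).ne'
  rw [Real.cot_eq_cos_div_sin, Real.tan_eq_sin_div_cos]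
  induction N with
  | zero =>
    simp only [Finset.range_zero, Finset.sum_empty, Nat.cast_zero, mul_zero, zero_add]
    rw [Real.cos_two_mul, div_sub_div _ _ hs hc, div_add_div _ _ hs hc]
    have := Real.sin_sq_add_cos_sq θ
    field_simp
    linear_combination (2 * Real.cos θ ^ 2) * this
  | succ N ih =>
    rw [Finset.sum_range_succ, ih]
    push_cast
    have e1 : (4 * (N : ℝ) + 2) * θ = 4 * (N + 1) * θ - 2 * θ := by ring
    have e2 : (4 * ((N : ℝ) + 1) + 2) * θ = 4 * (N + 1) * θ + 2 * θ := by ring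
    rw [e1, e2, Real.cos_sub, Real.cos_add, Real.cos_two_mul, Real.sin_two_mul]
    have := Real.sin_sq_add_cos_sq θ
    generalize 4 * ((N : ℝ) + 1) * θ = a
    field_simp
    linear_combination (-4 * Real.sin a * Real.sin θ * Real.cos θ) * this

/-- The Dirichlet kernel. -/
theorem sum_cos_eq {θ : ℝ} (h : θ ∈ Ioo 0 (Real.pi / 2)) (N : ℕ) :
    1 + ∑ k ∈ Finset.range N, 2 * Real.cos (4 * (k + 1) * θ) =
      (Real.cot θ + Real.tan θ) / 2 * Real.sin ((4 * N + 2) * θ) := by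
  have hs := (sin_pos_of_mem h).ne'
  have hc := (cos_pos_of_mem h).ne'
  rw [Real.cot_eq_cos_div_sin, Real.tan_eq_sin_div_cos]
  induction N with
  | zero =>
    simp only [Finset.range_zero, Finset.sum_empty, Nat.cast_zero, mul_zero, zero_add, add_zero]
    rw [Real.sin_two_mul, div_add_div _ _ hs hc]
    have := Real.sin_sq_add_cos_sq θ
    field_simp
    linear_combination -this
  | succ N ih =>
    rw [Finset.sum_range_succ, ← add_assoc, ih]
    push_cast
    have e1 : (4 * (N : ℝ) + 2) * θ = 4 * (N + 1) * θ - 2 * θ := by ring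
    have e2 : (4 * ((N : ℝ) + 1) + 2) * θ = 4 * (N + 1) * θ + 2 * θ := by ring
    rw [e1, e2, Real.sin_sub, Real.sin_add, Real.cos_two_mul, Real.sin_two_mul]
    have := Real.sin_sq_add_cos_sq θ
    generalize 4 * ((N : ℝ) + 1) * θ = a
    field_simp
    linear_combination (-4 * Real.cos a * Real.sin θ * Real.cos θ) * this

theorem one_sub_cos_pi_mul (z : ℝ) :
    1 - Real.cos (Real.pi * z) = 2 * Real.sin (Real.pi * z / 2) ^ 2 := by
  have h := Real.cos_two_mul (Real.pi * z / 2)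
  have h2 := Real.sin_sq_add_cos_sq (Real.pi * z / 2)
  rw [mul_div_cancel₀ _ two_ne_zero] at h
  linarith

/-- The cosine transform of `π / 2 - θ` at the frequency `4 k + 2 z`, in closed form. -/
theorem integral_sub_mul_cos_even {z : ℝ} (k : ℤ) (hz : 2 * k + z ≠ 0) :
    ∫ θ in (0 : ℝ)..Real.pi / 2, (Real.pi / 2 - θ) * Real.cos ((4 * k + 2 * z) * θ) =
      Real.sin (Real.pi * z / 2) ^ 2 / 2 * (1 / (2 * k + z) ^ 2) := by
  have h := integral_sub_mul_cos (y := 4 * k + 2 * z)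
    (by contrapose! hz; linarith) 0 (Real.pi / 2)
  simp only [sub_zero] at h
  rw [h, show (4 * k + 2 * z) * (Real.pi / 2) = Real.pi * z + k * (2 * Real.pi) by ring,
    Real.cos_add_int_mul_two_pi, one_sub_cos_pi_mul]
  have : 4 * k + 2 * z ≠ 0 := by contrapose! hz; linarith
  field_simp
  ring

theorem two_mul_int_add_ne_zero {z : ℝ} (hz : Real.sin (Real.pi * z / 2) ≠ 0) (k : ℤ) :
    2 * k + z ≠ 0 := by
  intro h
  apply hz
  have : Real.pi * z / 2 = (-k : ℤ) * Real.pi := by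
    push_cast
    linear_combination (Real.pi / 2) * h
  rw [this, Real.sin_int_mul_pi]

theorem continuous_sub_mul_cos (y : ℝ) :
    Continuous fun θ : ℝ => (Real.pi / 2 - θ) * Real.cos (y * θ) := by fun_prop

theorem intervalIntegral_congr_Ioo {f g : ℝ → ℝ} (h : ∀ θ ∈ Ioo 0 (Real.pi / 2), f θ = g θ) :
    ∫ θ in (0 : ℝ)..Real.pi / 2, f θ = ∫ θ in (0 : ℝ)..Real.pi / 2, g θ := by
  rw [intervalIntegral.integral_of_le (by positivity), integral_Ioc_eq_integral_Ioo,
    intervalIntegral.integral_of_le (by positivity), integral_Ioc_eq_integral_Ioo]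
  exact setIntegral_congr_fun measurableSet_Ioo h

/-- The partial fraction expansion of `cotTransform`: integrate the conjugate Dirichlet kernel
term by term, the remainder being negligible by the Riemann–Lebesgue lemma. -/
theorem cotTransform_two_mul {z : ℝ} (hz : Real.sin (Real.pi * z / 2) ≠ 0) :
    cotTransform (2 * z) =
      Real.sin (Real.pi * z / 2) ^ 2 * (trigammaSum (2 - z) - trigammaSum (2 + z)) := by
  set s := Real.sin (Real.pi * z / 2) with hs
  have hzn : Real.sin (Real.pi * (-z) / 2) ^ 2 = s ^ 2 := by
    rw [mul_neg, neg_div, Real.sin_neg, neg_sq]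
  have hsum : HasSum (fun k : ℕ => s ^ 2 * (1 / (2 - z + 2 * (k : ℝ)) ^ 2 -
      1 / (2 + z + 2 * (k : ℝ)) ^ 2)) (s ^ 2 * (trigammaSum (2 - z) - trigammaSum (2 + z))) :=
    (((summable_trigammaSum _).hasSum.sub (summable_trigammaSum _).hasSum).mul_left _)
  refine tendsto_nhds_unique ?_ hsum.tendsto_sum_nat
  have hterm : ∀ k : ℕ, s ^ 2 * (1 / (2 - z + 2 * (k : ℝ)) ^ 2 - 1 / (2 + z + 2 * (k : ℝ)) ^ 2) =
      ∫ θ in (0 : ℝ)..Real.pi / 2, (Real.pi / 2 - θ) * (4 * Real.sin (4 * (k + 1) * θ)) *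
        Real.sin (2 * z * θ) := by
    intro k
    have h1 := integral_sub_mul_cos_even (k + 1) (two_mul_int_add_ne_zero hz (k + 1))
    have h2 := integral_sub_mul_cos_even (z := -z) (k + 1) (by
      have := two_mul_int_add_ne_zero hz (-(k + 1))
      contrapose! this
      push_cast at this ⊢
      linarith)
    rw [hzn] at h2
    rw [← hs] at h1
    push_cast at h1 h2
    have h3 : ∫ θ in (0 : ℝ)..Real.pi / 2, (Real.pi / 2 - θ) * (4 * Real.sin (4 * (k + 1) * θ)) *
        Real.sin (2 * z * θ) = ∫ θ in (0 : ℝ)..Real.pi / 2,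
          (2 * ((Real.pi / 2 - θ) * Real.cos ((4 * ((k : ℝ) + 1) + 2 * -z) * θ)) -
          2 * ((Real.pi / 2 - θ) * Real.cos ((4 * ((k : ℝ) + 1) + 2 * z) * θ))) := by
      refine intervalIntegral.integral_congr fun θ _ => ?_
      rw [show (4 * ((k : ℝ) + 1) + 2 * -z) * θ = 4 * (k + 1) * θ - 2 * z * θ by ring,
        show (4 * ((k : ℝ) + 1) + 2 * z) * θ = 4 * (k + 1) * θ + 2 * z * θ by ring,
        Real.cos_sub, Real.cos_add]
      ring
    rw [h3, intervalIntegral.integral_sub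
      (((continuous_sub_mul_cos _).intervalIntegrable _ _).const_mul _)
      (((continuous_sub_mul_cos _).intervalIntegrable _ _).const_mul _),
      intervalIntegral.integral_const_mul, intervalIntegral.integral_const_mul, h1, h2]
    ring_nf
  simp only [hterm]
  have i1 := intervalIntegrable_tan_mul (f := fun θ => Real.sin (2 * z * θ)) (by fun_prop)
  have i2 := intervalIntegrable_cot_mul_sin (2 * z) (f := fun θ => Real.pi / 2 - θ) (by fun_prop)
  have hlim := (tendsto_integral_mul_cos_sin_interval (i2.add i1)).1.const_sub
    (cotTransform (2 * z))
  rw [sub_zero] at hlim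
  refine hlim.congr fun N => ?_
  rw [← intervalIntegral.integral_finsetSum, cotTransform, ← intervalIntegral.integral_sub]
  · refine intervalIntegral_congr_Ioo fun θ hθ => ?_
    rw [← Finset.sum_mul, ← Finset.mul_sum, sum_sin_eq hθ]
    ring
  · refine (i2.sub i1).congr fun θ _ => ?_
    ring
  · exact (i2.add i1).mul_continuousOn (by fun_prop)
  · intro k _
    exact Continuous.intervalIntegrable (by fun_prop) _ _

/-- The reflection formula for the trigamma function. -/
theorem trigammaSum_reflection {z : ℝ} (hz : Real.sin (Real.pi * z / 2) ≠ 0) :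
    trigammaSum z + trigammaSum (2 - z) = Real.pi ^ 2 / (4 * Real.sin (Real.pi * z / 2) ^ 2) := by
  set s := Real.sin (Real.pi * z / 2) with hs
  have hzn : Real.sin (Real.pi * (-z) / 2) ^ 2 = s ^ 2 := by
    rw [mul_neg, neg_div, Real.sin_neg, neg_sq]
  have hsum := (((summable_trigammaSum (2 - z)).hasSum.add
    (summable_trigammaSum (2 + z)).hasSum).mul_left (s ^ 2 / 2)).tendsto_sum_nat.const_add
      (s ^ 2 / 2 * (1 / z ^ 2) - Real.pi ^ 2 / 8)
  have key : s ^ 2 / 2 * (1 / z ^ 2) - Real.pi ^ 2 / 8 +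
      s ^ 2 / 2 * (trigammaSum (2 - z) + trigammaSum (2 + z)) = 0 := by
    refine tendsto_nhds_unique hsum ?_
    have h0 : ∫ θ in (0 : ℝ)..Real.pi / 2, (Real.pi / 2 - θ) * (Real.cos (2 * z * θ) - 1) =
        s ^ 2 / 2 * (1 / z ^ 2) - Real.pi ^ 2 / 8 := by
      have h1 := integral_sub_mul_cos_even 0 (two_mul_int_add_ne_zero hz 0)
      simp only [Int.cast_zero, mul_zero, zero_add, ← hs] at h1
      have h2 : ∫ θ in (0 : ℝ)..Real.pi / 2, (Real.pi / 2 - θ) = Real.pi ^ 2 / 8 := by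
        rw [intervalIntegral.integral_comp_sub_left fun u => u, integral_id]
        ring
      rw [← h1, ← h2, ← intervalIntegral.integral_sub
        ((continuous_sub_mul_cos _).intervalIntegrable _ _)
        (Continuous.intervalIntegrable (by fun_prop) _ _)]
      refine intervalIntegral.integral_congr fun θ _ => ?_
      ring
    have hterm : ∀ k : ℕ, s ^ 2 / 2 * (1 / (2 - z + 2 * (k : ℝ)) ^ 2 +
        1 / (2 + z + 2 * (k : ℝ)) ^ 2) =
        ∫ θ in (0 : ℝ)..Real.pi / 2, (Real.pi / 2 - θ) * (Real.cos (2 * z * θ) - 1) *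
          (2 * Real.cos (4 * (k + 1) * θ)) := by
      intro k
      have h1 := integral_sub_mul_cos_even (k + 1) (two_mul_int_add_ne_zero hz (k + 1))
      have h2 := integral_sub_mul_cos_even (z := -z) (k + 1) (by
        have := two_mul_int_add_ne_zero hz (-(k + 1))
        contrapose! this
        push_cast at this ⊢
        linarith)
      have h4 := integral_sub_mul_cos_even (z := 0) (k + 1) (by
        push_cast
        positivity)
      rw [hzn] at h2
      rw [← hs] at h1
      push_cast at h1 h2 h4
      have h3 : ∫ θ in (0 : ℝ)..Real.pi / 2, (Real.pi / 2 - θ) * (Real.cos (2 * z * θ) - 1) *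
          (2 * Real.cos (4 * (k + 1) * θ)) = ∫ θ in (0 : ℝ)..Real.pi / 2,
            ((Real.pi / 2 - θ) * Real.cos ((4 * ((k : ℝ) + 1) + 2 * -z) * θ) +
            (Real.pi / 2 - θ) * Real.cos ((4 * ((k : ℝ) + 1) + 2 * z) * θ) -
            2 * ((Real.pi / 2 - θ) * Real.cos ((4 * ((k : ℝ) + 1) + 2 * 0) * θ))) := by
        refine intervalIntegral.integral_congr fun θ _ => ?_
        rw [show (4 * ((k : ℝ) + 1) + 2 * -z) * θ = 4 * (k + 1) * θ - 2 * z * θ by ring,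
          show (4 * ((k : ℝ) + 1) + 2 * z) * θ = 4 * (k + 1) * θ + 2 * z * θ by ring,
          Real.cos_sub, Real.cos_add, mul_zero, add_zero]
        ring
      have c1 := fun y => (continuous_sub_mul_cos y).intervalIntegrable (μ := volume) 0
        (Real.pi / 2)
      rw [h3, intervalIntegral.integral_sub ((c1 _).add (c1 _)) ((c1 _).const_mul _),
        intervalIntegral.integral_add (c1 _) (c1 _),
        intervalIntegral.integral_const_mul, h1, h2, h4]
      simp only [mul_zero, zero_div, Real.sin_zero]
      ring_nf
    simp only [hterm, ← h0]
    -- The factor `cos (2 z θ) - 1 = -2 sin (z θ) ^ 2` cancels the pole of the Dirichlet kernel.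
    have hcos : ∀ θ : ℝ, Real.cos (2 * z * θ) - 1 = -2 * Real.sin (z * θ) * Real.sin (z * θ) := by
      intro θ
      have h2 := Real.sin_sq_add_cos_sq (z * θ)
      rw [mul_assoc, Real.cos_two_mul]
      linarith
    have i1 := intervalIntegrable_tan_mul (f := fun θ => (Real.cos (2 * z * θ) - 1) / 2)
      (by fun_prop)
    have i2 := intervalIntegrable_cot_mul_sin z
      (f := fun θ => (Real.pi / 2 - θ) * (-Real.sin (z * θ))) (by fun_prop)
    refine (tendsto_integral_mul_cos_sin_interval (i2.add i1)).2.congr fun N => ?_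
    rw [← intervalIntegral.integral_finsetSum, ← intervalIntegral.integral_add]
    · refine intervalIntegral_congr_Ioo fun θ hθ => ?_
      have h := sum_cos_eq hθ N
      rw [← Finset.mul_sum]
      have e : ∀ a S : ℝ, a + a * S = a * (1 + S) := fun a S => by ring
      rw [e, h, hcos]
      ring
    · exact Continuous.intervalIntegrable (by fun_prop) _ _
    · exact Continuous.intervalIntegrable (by fun_prop) _ _
    · intro k _
      exact Continuous.intervalIntegrable (by fun_prop) _ _
  rw [trigammaSum_eq_add z, add_comm z 2, eq_div_iff (by positivity)]
  linear_combination 8 * key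

/-! ### The closed form of the generating function -/

/-- The sum `∑ (1 / (k - z) ^ 2 - 1 / (k + z) ^ 2)` over even `k > 0`. -/
noncomputable def evenPart (z : ℝ) : ℝ := trigammaSum (2 - z) - trigammaSum (2 + z)

/-- The sum `∑ (1 / (k - z) ^ 2 - 1 / (k + z) ^ 2)` over odd `k > 0`. -/
noncomputable def oddPart (z : ℝ) : ℝ := trigammaSum (1 - z) - trigammaSum (1 + z)

/-- The generating function at `2 z`, up to a factor `8` and an additive constant. -/
noncomputable def closedForm (z : ℝ) : ℝ :=
  Real.cos (Real.pi * z / 2) ^ 2 * oddPart z ^ 2 + Real.sin (Real.pi * z / 2) ^ 2 * evenPart z ^ 2 -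
    Real.pi ^ 2 / 4 * (Real.pi ^ 2 / Real.sin (Real.pi * z) ^ 2 - 1 / z ^ 2)

theorem sin_pi_mul (z : ℝ) : Real.sin (Real.pi * z) =
    2 * Real.sin (Real.pi * z / 2) * Real.cos (Real.pi * z / 2) := by
  rw [← Real.sin_two_mul, mul_div_cancel₀ _ two_ne_zero]

theorem sin_pi_mul_add_one_div_two (z : ℝ) :
    Real.sin (Real.pi * (z + 1) / 2) = Real.cos (Real.pi * z / 2) := by
  rw [← Real.sin_add_pi_div_two]
  ring_nf

theorem cos_pi_mul_add_one_div_two (z : ℝ) :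
    Real.cos (Real.pi * (z + 1) / 2) = -Real.sin (Real.pi * z / 2) := by
  rw [← Real.cos_add_pi_div_two]
  ring_nf

theorem evenPart_add_one (z : ℝ) : evenPart (z + 1) = oddPart z + 1 / (1 + z) ^ 2 := by
  rw [evenPart, oddPart, trigammaSum_eq_add (1 + z)]
  ring_nf

theorem oddPart_add_one (z : ℝ) : oddPart (z + 1) = evenPart z + 1 / z ^ 2 := by
  rw [evenPart, oddPart, show 1 - (z + 1) = -z by ring, trigammaSum_eq_add (-z), neg_sq]
  ring_nf

theorem cubicTransform_two_mul {z : ℝ} (hz : z ≠ 0) : cubicTransform (2 * z) =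
    Real.pi ^ 2 / (32 * z ^ 2) - Real.sin (Real.pi * z / 2) ^ 2 / (8 * z ^ 4) := by
  rw [cubicTransform, show 2 * z * (Real.pi / 2) = Real.pi * z by ring, one_sub_cos_pi_mul]
  field_simp
  ring

theorem ne_zero_of_sin_pi_mul_ne_zero {z : ℝ} (hz : Real.sin (Real.pi * z) ≠ 0) : z ≠ 0 := by
  rintro rfl
  simp at hz

theorem sin_pi_mul_add_one (z : ℝ) : Real.sin (Real.pi * (z + 1)) = -Real.sin (Real.pi * z) := by
  rw [mul_add, mul_one, Real.sin_add_pi]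

/-- The closed form satisfies the difference equation of `generating_add_two`: a translation by `1`
exchanges sine and cosine, and even and odd parts. -/
theorem generating_sub_closedForm_add_one {z : ℝ} (hz : Real.sin (Real.pi * z) ≠ 0) :
    8 * generating (2 * (z + 1)) - closedForm (z + 1) =
      8 * generating (2 * z) - closedForm z := by
  have hz' : Real.sin (Real.pi * (z + 1)) ≠ 0 := by
    rw [sin_pi_mul_add_one]
    exact neg_ne_zero.mpr hz
  have h0 := ne_zero_of_sin_pi_mul_ne_zero hz
  have h1 := ne_zero_of_sin_pi_mul_ne_zero hz'
  have h1' : 1 + z ≠ 0 := by rwa [add_comm]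
  have hs := hz
  rw [sin_pi_mul] at hs
  have hs1 := left_ne_zero_of_mul hs |> right_ne_zero_of_mul
  have hc1 := right_ne_zero_of_mul hs
  have hd := generating_add_two (x := 2 * z) (by positivity) (by
    contrapose! h1
    linarith)
  rw [show 2 * z + 2 = 2 * (z + 1) by ring, cotTransform_two_mul hs1,
    cotTransform_two_mul (by rwa [sin_pi_mul_add_one_div_two]), cubicTransform_two_mul h0,
    cubicTransform_two_mul h1, sin_pi_mul_add_one_div_two] at hd
  change _ = _ * evenPart (z + 1) / _ + _ * evenPart z / _ + _ at hd
  have hp := trigammaSum_reflection hs1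
  rw [closedForm, closedForm, sin_pi_mul_add_one_div_two, cos_pi_mul_add_one_div_two,
    sin_pi_mul_add_one, oddPart_add_one, evenPart_add_one]
  rw [evenPart_add_one] at hd
  have hg : generating (2 * (z + 1)) = generating (2 * z) + (generating (2 * (z + 1)) -
    generating (2 * z)) := by ring
  rw [hg, hd, add_comm 1 z, neg_sq]
  field_simp
  ring

/-- By reflection all trigamma sums are taken at arguments tending to `+∞` with `z`, and the terms of
order `π ^ 4` cancel. -/
theorem closedForm_eq {z : ℝ} (hz : Real.sin (Real.pi * z) ≠ 0) :
    closedForm z = -Real.pi ^ 2 * trigammaSum (z + 1) +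
      4 * Real.cos (Real.pi * z / 2) ^ 2 * trigammaSum (z + 1) ^ 2 -
      Real.pi ^ 2 / 2 * (trigammaSum z + trigammaSum (z + 2)) +
      Real.sin (Real.pi * z / 2) ^ 2 * (trigammaSum z + trigammaSum (z + 2)) ^ 2 +
      Real.pi ^ 2 / 4 * (1 / z ^ 2) := by
  have h0 := ne_zero_of_sin_pi_mul_ne_zero hz
  have hs := hz
  rw [sin_pi_mul] at hs
  have hs1 := left_ne_zero_of_mul hs |> right_ne_zero_of_mul
  have hc1 := right_ne_zero_of_mul hs
  have he : evenPart z = Real.pi ^ 2 / (4 * Real.sin (Real.pi * z / 2) ^ 2) -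
      (trigammaSum z + trigammaSum (z + 2)) := by
    rw [← trigammaSum_reflection hs1, evenPart, add_comm z 2]
    ring
  have ho : oddPart z = Real.pi ^ 2 / (4 * Real.cos (Real.pi * z / 2) ^ 2) -
      2 * trigammaSum (z + 1) := by
    have h := trigammaSum_reflection (z := z + 1) (by rwa [sin_pi_mul_add_one_div_two])
    rw [sin_pi_mul_add_one_div_two, show 2 - (z + 1) = 1 - z by ring] at h
    rw [← h, oddPart, add_comm z 1]
    ring
  rw [closedForm, he, ho, sin_pi_mul]
  have h := Real.sin_sq_add_cos_sq (Real.pi * z / 2)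
  generalize Real.sin (Real.pi * z / 2) = s at *
  generalize Real.cos (Real.pi * z / 2) = c at *
  generalize trigammaSum (z + 1) = a
  generalize trigammaSum z + trigammaSum (z + 2) = b
  have e1 : c ^ 2 * (Real.pi ^ 2 / (4 * c ^ 2) - 2 * a) ^ 2 =
      Real.pi ^ 4 / (16 * c ^ 2) - Real.pi ^ 2 * a + 4 * c ^ 2 * a ^ 2 := by
    field_simp
    ring
  have e2 : s ^ 2 * (Real.pi ^ 2 / (4 * s ^ 2) - b) ^ 2 =
      Real.pi ^ 4 / (16 * s ^ 2) - Real.pi ^ 2 / 2 * b + s ^ 2 * b ^ 2 := by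
    field_simp
    ring
  have e3 : Real.pi ^ 4 / (16 * c ^ 2) + Real.pi ^ 4 / (16 * s ^ 2) =
      Real.pi ^ 2 / 4 * (Real.pi ^ 2 / (2 * s * c) ^ 2) := by
    field_simp
    linear_combination 16 * h
  rw [e1, e2]
  linear_combination e3

theorem sin_pi_mul_add_nat {z : ℝ} (hz : Real.sin (Real.pi * z) ≠ 0) (m : ℕ) :
    Real.sin (Real.pi * (z + m)) ≠ 0 := by
  induction m with
  | zero => simpa using hz
  | succ m ih =>
    push_cast
    rw [← add_assoc, sin_pi_mul_add_one]
    exact neg_ne_zero.mpr ih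

theorem tendsto_closedForm {z : ℝ} (hz : Real.sin (Real.pi * z) ≠ 0) :
    Tendsto (fun m : ℕ => closedForm (z + 4 * m)) atTop (𝓝 0) := by
  have hs : ∀ m : ℕ, Real.sin (Real.pi * (z + 4 * m)) ≠ 0 := by
    intro m
    have := sin_pi_mul_add_nat hz (4 * m)
    push_cast at this
    exact this
  have e1 : ∀ m : ℕ, Real.sin (Real.pi * (z + 4 * m) / 2) = Real.sin (Real.pi * z / 2) := by
    intro m
    rw [show Real.pi * (z + 4 * m) / 2 = Real.pi * z / 2 + m * (2 * Real.pi) by ring,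
      Real.sin_add_nat_mul_two_pi]
  have e2 : ∀ m : ℕ, Real.cos (Real.pi * (z + 4 * m) / 2) = Real.cos (Real.pi * z / 2) := by
    intro m
    rw [show Real.pi * (z + 4 * m) / 2 = Real.pi * z / 2 + m * (2 * Real.pi) by ring,
      Real.cos_add_nat_mul_two_pi]
  have t0 := tendsto_trigammaSum z
  have t1 : Tendsto (fun m : ℕ => trigammaSum (z + 4 * m + 1)) atTop (𝓝 0) := by
    simpa only [add_right_comm] using tendsto_trigammaSum (z + 1)
  have t2 : Tendsto (fun m : ℕ => trigammaSum (z + 4 * m + 2)) atTop (𝓝 0) := by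
    simpa only [add_right_comm] using tendsto_trigammaSum (z + 2)
  have t3 : Tendsto (fun m : ℕ => 1 / (z + 4 * (m : ℝ)) ^ 2) atTop (𝓝 0) := by
    have h : Tendsto (fun m : ℕ => z + 4 * (m : ℝ)) atTop atTop :=
      tendsto_atTop_add_const_left _ _
        (tendsto_natCast_atTop_atTop.const_mul_atTop (by norm_num))
    exact (((tendsto_pow_atTop two_ne_zero).comp h).inv_tendsto_atTop).congr fun m => by simp
  simp only [fun m => closedForm_eq (hs m), e1, e2]
  have h := (((t1.const_mul (-Real.pi ^ 2)).add
    ((t1.pow 2).const_mul (4 * Real.cos (Real.pi * z / 2) ^ 2))).sub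
    ((t0.add t2).const_mul (Real.pi ^ 2 / 2))).add
    (((t0.add t2).pow 2).const_mul (Real.sin (Real.pi * z / 2) ^ 2)) |>.add
    (t3.const_mul (Real.pi ^ 2 / 4))
  simpa using h

/-- The difference of the two sides is invariant under `z ↦ z + 1` and tends to zero. -/
theorem generating_two_mul {z : ℝ} (hz : Real.sin (Real.pi * z) ≠ 0) :
    8 * generating (2 * z) = 8 * (∫ p in triangle, weight p) + closedForm z := by
  have hper : ∀ m : ℕ, 8 * generating (2 * (z + m)) - closedForm (z + m) =
      8 * generating (2 * z) - closedForm z := by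
    intro m
    induction m with
    | zero => simp
    | succ m ih =>
      push_cast
      rw [← add_assoc, generating_sub_closedForm_add_one (sin_pi_mul_add_nat hz m), ih]
  have h4 : Tendsto (fun m : ℕ => 2 * (z + 4 * (m : ℝ))) atTop atTop :=
    (tendsto_atTop_add_const_left _ _
      (tendsto_natCast_atTop_atTop.const_mul_atTop (by norm_num))).const_mul_atTop two_pos
  have hlim := ((tendsto_generating.comp h4).const_mul 8).sub (tendsto_closedForm hz)
  have hconst : Tendsto (fun m : ℕ => 8 * generating (2 * (z + 4 * (m : ℝ))) -
      closedForm (z + 4 * m)) atTop (𝓝 (8 * generating (2 * z) - closedForm z)) := by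
    refine tendsto_const_nhds.congr fun m => ?_
    have := hper (4 * m)
    push_cast at this
    exact this.symm
  have := tendsto_nhds_unique hconst hlim
  linarith

/-! ### Power series expansions -/

open PowerSeries

/-- The power series `f` converges at `w` with sum `a`. -/
def HasValue (f : PowerSeries ℝ) (w a : ℝ) : Prop := HasSum (fun m => coeff m f * w ^ m) a

theorem HasValue.add {f g : PowerSeries ℝ} {w a b : ℝ} (hf : HasValue f w a)
    (hg : HasValue g w b) : HasValue (f + g) w (a + b) := by
  unfold HasValue at *
  simp only [map_add, add_mul]
  exact HasSum.add hf hg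

theorem HasValue.sub {f g : PowerSeries ℝ} {w a b : ℝ} (hf : HasValue f w a)
    (hg : HasValue g w b) : HasValue (f - g) w (a - b) := by
  unfold HasValue at *
  simp only [map_sub, sub_mul]
  exact HasSum.sub hf hg

theorem HasValue.smul {f : PowerSeries ℝ} {w a : ℝ} (hf : HasValue f w a) (c : ℝ) :
    HasValue (c • f) w (c * a) := by
  unfold HasValue at *
  simp only [PowerSeries.coeff_smul, smul_eq_mul, mul_assoc]
  exact HasSum.mul_left c hf

theorem HasValue.mul {f g : PowerSeries ℝ} {w a b : ℝ} (hf : HasValue f w a)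
    (hg : HasValue g w b) : HasValue (f * g) w (a * b) := by
  unfold HasValue at *
  have hf' : Summable fun m => ‖coeff m f * w ^ m‖ := hf.summable.norm
  have hg' : Summable fun m => ‖coeff m g * w ^ m‖ := hg.summable.norm
  have e : ∀ m, coeff m (f * g) * w ^ m = ∑ x ∈ Finset.HasAntidiagonal.antidiagonal m,
      coeff x.1 f * w ^ x.1 * (coeff x.2 g * w ^ x.2) := by
    intro m
    rw [PowerSeries.coeff_mul, Finset.sum_mul]
    refine Finset.sum_congr rfl fun x hx => ?_
    rw [← Finset.HasAntidiagonal.mem_antidiagonal.mp hx, pow_add]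
    ring
  simp only [e]
  rw [← hf.tsum_eq, ← hg.tsum_eq, tsum_mul_tsum_eq_tsum_sum_antidiagonal_of_summable_norm hf' hg']
  exact (summable_norm_sum_mul_antidiagonal_of_summable_norm hf' hg').of_norm.hasSum

theorem hasValue_X (w : ℝ) : HasValue X w w := by
  unfold HasValue
  have h := hasSum_single (f := fun m => coeff m (X : PowerSeries ℝ) * w ^ m) 1 fun m hm => by
    simp [PowerSeries.coeff_X, hm]
  simpa using h

/-- The coefficients of a power series are determined by its values on `(0, 1)`. -/
theorem eq_zero_of_hasValue {f : PowerSeries ℝ} (h : ∀ w ∈ Ioo (0 : ℝ) 1, HasValue f w 0) :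
    f = 0 := by
  ext m
  rw [map_zero]
  induction m using Nat.strong_induction_on with
  | _ m ih =>
    have hB : Summable fun j => |coeff (j + (m + 1)) f * (1 / 2) ^ j| := by
      have h1 := ((h (1 / 2) (by norm_num)).summable.abs.comp_injective
        (add_left_injective (m + 1))).mul_right (2 ^ (m + 1))
      refine h1.congr fun j => ?_
      simp only [Function.comp]
      rw [pow_add, ← mul_assoc, abs_mul _ ((1 / 2 : ℝ) ^ (m + 1)),
        abs_of_pos (a := (1 / 2 : ℝ) ^ (m + 1)) (by positivity), mul_assoc, ← mul_pow]
      norm_num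
    set B := ∑' j, |coeff (j + (m + 1)) f * (1 / 2) ^ j| with hBdef
    have hbound : ∀ w ∈ Ioo (0 : ℝ) (1 / 2), |coeff m f| ≤ w * B := by
      intro w hw
      have h1 : HasValue f w 0 := h w ⟨hw.1, by linarith [hw.2]⟩
      have h2 := (hasSum_nat_add_iff' (m + 1)).mpr h1
      rw [Finset.sum_range_succ, Finset.sum_eq_zero (fun j hj => by
        rw [ih j (Finset.mem_range.mp hj), zero_mul]), zero_add, zero_sub] at h2
      have h3 := h2.norm_le_of_bounded (hB.hasSum.mul_left (w ^ (m + 1))) (fun j => by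
        rw [Real.norm_eq_abs, abs_mul, abs_mul, abs_pow, abs_pow, abs_of_pos hw.1, pow_add]
        have : w ^ j ≤ |1 / 2| ^ j := by
          rw [abs_of_pos (by norm_num)]
          exact pow_le_pow_left₀ hw.1.le hw.2.le j
        calc |coeff (j + (m + 1)) f| * (w ^ j * w ^ (m + 1))
            = w ^ (m + 1) * (|coeff (j + (m + 1)) f| * w ^ j) := by ring
          _ ≤ _ := by
            have := hw.1
            gcongr)
      rw [Real.norm_eq_abs, abs_neg, abs_mul, abs_pow, abs_of_pos hw.1, mul_comm, pow_succ,
        mul_assoc] at h3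
      exact le_of_mul_le_mul_left h3 (pow_pos hw.1 m)
    have hlim : Tendsto (fun w : ℝ => w * B) (𝓝[>] 0) (𝓝 0) := by
      have : Tendsto (fun w : ℝ => w * B) (𝓝 0) (𝓝 (0 * B)) :=
        (continuous_id.mul continuous_const).tendsto 0
      rw [zero_mul] at this
      exact this.mono_left nhdsWithin_le_nhds
    have h0 : |coeff m f| ≤ 0 := ge_of_tendsto hlim (by
      filter_upwards [Ioo_mem_nhdsGT (show (0 : ℝ) < 1 / 2 by norm_num)] with w hw
      exact hbound w hw)
    exact abs_nonpos_iff.mp h0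

/-- The zeta value `ζ(k)` as a real number. -/
noncomputable def realZeta (k : ℕ) : ℝ := ∑' n : ℕ, 1 / ((n : ℝ) + 1) ^ k

theorem ofReal_realZeta {k : ℕ} (hk : 1 < k) : (realZeta k : ℂ) = riemannZeta k := by
  rw [zeta_nat_eq_tsum_of_gt_one hk, realZeta, Complex.ofReal_tsum]
  have hs : Summable fun n : ℕ => 1 / (n : ℂ) ^ k := by
    have h := Complex.summable_ofReal.mpr ((Real.summable_one_div_nat_pow (p := k)).mpr hk)
    simpa using h
  rw [hs.tsum_eq_zero_add]
  have : (0 : ℂ) ^ k = 0 := zero_pow (by omega)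
  simp [this]

/-- The sum `∑ 1 / (n - z) ^ 2` over `n ≥ 1`. -/
noncomputable def shiftedSum (z : ℝ) : ℝ := ∑' n : ℕ, 1 / ((n : ℝ) + 1 - z) ^ 2

/-- Expand each summand as a derivative of a geometric series and exchange the sums. -/
theorem hasSum_shiftedSum {z : ℝ} (hz : |z| < 1) :
    HasSum (fun m : ℕ => ((m : ℝ) + 1) * realZeta (m + 2) * z ^ m) (shiftedSum z) := by
  have hgeom : ∀ y : ℝ, |y| < 1 →
      HasSum (fun m : ℕ => ((m : ℝ) + 1) * y ^ m) (1 / (1 - y) ^ 2) := by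
    intro y hy
    have h := hasSum_choose_mul_geometric_of_norm_lt_one 1 (r := y) (by simpa using hy)
    simpa using h
  have hsq : Summable fun n : ℕ => 1 / ((n : ℝ) + 1) ^ 2 := by
    have h := (summable_nat_add_iff 1).mpr ((Real.summable_one_div_nat_pow (p := 2)).mpr one_lt_two)
    simpa using h
  have hprod : Summable fun x : ℕ × ℕ =>
      1 / ((x.1 : ℝ) + 1) ^ 2 * (((x.2 : ℝ) + 1) * |z| ^ x.2) :=
    hsq.mul_of_nonneg (hgeom |z| (by simpa using hz)).summable (fun n => by positivity)
      (fun m => by positivity)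
  have hs : Summable fun x : ℕ × ℕ => ((x.2 : ℝ) + 1) * z ^ x.2 / ((x.1 : ℝ) + 1) ^ (x.2 + 2) := by
    refine Summable.of_norm_bounded hprod fun x => ?_
    have h1 : (1 : ℝ) ≤ (x.1 : ℝ) + 1 := by linarith [(Nat.cast_nonneg x.1 : (0 : ℝ) ≤ x.1)]
    have h2 : ((x.1 : ℝ) + 1) ^ 2 ≤ ((x.1 : ℝ) + 1) ^ (x.2 + 2) :=
      pow_le_pow_right₀ h1 (by omega)
    rw [Real.norm_eq_abs, abs_div, abs_mul, abs_pow z,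
      abs_of_nonneg (a := (x.2 : ℝ) + 1) (by positivity),
      abs_of_nonneg (a := ((x.1 : ℝ) + 1) ^ (x.2 + 2)) (by positivity), one_div_mul_eq_div]
    gcongr
  have hfix : ∀ n : ℕ, HasSum (fun m : ℕ => ((m : ℝ) + 1) * z ^ m / ((n : ℝ) + 1) ^ (m + 2))
      (1 / ((n : ℝ) + 1 - z) ^ 2) := by
    intro n
    have hn : (0 : ℝ) < (n : ℝ) + 1 := by positivity
    have hy : |z / ((n : ℝ) + 1)| < 1 := by
      rw [abs_div, abs_of_pos hn, div_lt_one hn]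
      have : (0 : ℝ) ≤ n := Nat.cast_nonneg n
      linarith
    have h := (hgeom _ hy).mul_left (1 / ((n : ℝ) + 1) ^ 2)
    have e : 1 / ((n : ℝ) + 1) ^ 2 * (1 / (1 - z / ((n : ℝ) + 1)) ^ 2) =
        1 / ((n : ℝ) + 1 - z) ^ 2 := by
      rw [one_div_mul_one_div, ← mul_pow, mul_sub, mul_one, mul_div_cancel₀ _ hn.ne']
    rw [e] at h
    refine h.congr_fun fun m => ?_
    rw [div_pow, pow_add]
    field_simp
  have hcol : ∀ m : ℕ, HasSum (fun n : ℕ => ((m : ℝ) + 1) * z ^ m / ((n : ℝ) + 1) ^ (m + 2))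
      (((m : ℝ) + 1) * realZeta (m + 2) * z ^ m) := by
    intro m
    have hz2 : Summable fun n : ℕ => 1 / ((n : ℝ) + 1) ^ (m + 2) := by
      have h := (summable_nat_add_iff 1).mpr
        ((Real.summable_one_div_nat_pow (p := m + 2)).mpr (by omega))
      simpa using h
    have h := hz2.hasSum.mul_left (((m : ℝ) + 1) * z ^ m)
    rw [mul_right_comm, realZeta]
    simpa only [mul_one_div] using h
  have h1 : shiftedSum z = ∑' x : ℕ × ℕ, ((x.2 : ℝ) + 1) * z ^ x.2 / ((x.1 : ℝ) + 1) ^ (x.2 + 2) :=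
    (hs.hasSum.prod_fiberwise hfix).tsum_eq
  rw [h1]
  exact ((Equiv.prodComm ℕ ℕ).hasSum_iff.mpr hs.hasSum).prod_fiberwise hcol

theorem summable_shiftedSum (z : ℝ) : Summable fun n : ℕ => 1 / ((n : ℝ) + 1 - z) ^ 2 := by
  have h := (summable_trigammaSum (2 * (1 - z))).mul_left 4
  refine h.congr fun n => ?_
  rw [show 2 * (1 - z) + 2 * (n : ℝ) = 2 * (n + 1 - z) by ring, mul_pow]
  rw [one_div, one_div, mul_inv]
  norm_num
  ring

theorem shiftedSum_eq (z : ℝ) : shiftedSum z = trigammaSum (1 - z) + trigammaSum (2 - z) := by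
  have hs := summable_shiftedSum z
  have h1 : Function.Injective fun k : ℕ => 2 * k := fun a b h => by simpa using h
  have h2 : Function.Injective fun k : ℕ => 2 * k + 1 := fun a b h => by simpa using h
  have h := tsum_even_add_odd (f := fun n : ℕ => 1 / ((n : ℝ) + 1 - z) ^ 2)
    (hs.comp_injective h1) (hs.comp_injective h2)
  rw [shiftedSum, ← h, trigammaSum, trigammaSum]
  congr 1
  · refine tsum_congr fun k => ?_
    push_cast
    rw [add_comm (1 - z), add_sub_assoc]
  · refine tsum_congr fun k => ?_
    push_cast
    rw [show 2 * (k : ℝ) + 1 + 1 - z = 2 - z + 2 * k by ring]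

theorem trigammaSum_two_sub (z : ℝ) : trigammaSum (2 - z) = shiftedSum (z / 2) / 4 := by
  rw [trigammaSum, shiftedSum, ← tsum_div_const]
  refine tsum_congr fun k => ?_
  rw [show 2 - z + 2 * (k : ℝ) = 2 * (k + 1 - z / 2) by ring, mul_pow, one_div, one_div, mul_inv]
  norm_num
  ring

/-- The series `∑ r ζ(2 r + 1) X ^ r`. The factor `r` removes the divergent term `ζ(1)`. -/
noncomputable def oddZetaSeries : PowerSeries ℝ := PowerSeries.mk fun r => r * realZeta (2 * r + 1)

/-- The series `∑ r ζ(2 r + 1) (X / 4) ^ r`. -/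
noncomputable def oddZetaSeriesQuarter : PowerSeries ℝ :=
  PowerSeries.mk fun r => (1 / 4) ^ r * (r * realZeta (2 * r + 1))

/-- The series `∑ 2 (2 m - 1) ζ(2 m) X ^ m` over `m ≥ 1`. -/
noncomputable def evenZetaSeries : PowerSeries ℝ :=
  PowerSeries.mk fun m => if m = 0 then 0 else 2 * (2 * m - 1) * realZeta (2 * m)

/-- The series of `cos (π z) - 1` in `X = z ^ 2`. -/
noncomputable def cosSeries : PowerSeries ℝ :=
  PowerSeries.mk fun q => if q = 0 then 0 else (-1) ^ q * (Real.pi ^ (2 * q) / (2 * q).factorial)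

theorem hasSum_even_odd {f : ℕ → ℝ} {a : ℝ} (h : HasSum f a) :
    HasSum (fun k => f (2 * k)) (∑' k, f (2 * k)) ∧
      HasSum (fun k => f (2 * k + 1)) (∑' k, f (2 * k + 1)) ∧
      ∑' k, f (2 * k) + ∑' k, f (2 * k + 1) = a := by
  have h1 : Summable fun k => f (2 * k) := h.summable.comp_injective fun a b h => by simpa using h
  have h2 : Summable fun k => f (2 * k + 1) :=
    h.summable.comp_injective (i := fun k => 2 * k + 1) fun a b h => by simpa using h
  exact ⟨h1.hasSum, h2.hasSum, (tsum_even_add_odd h1 h2).trans h.tsum_eq⟩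

theorem hasSum_shiftedSum_parts {z : ℝ} (hz : |z| < 1) :
    HasSum (fun k : ℕ => 2 * (2 * (k : ℝ) + 1) * realZeta (2 * k + 2) * z ^ (2 * k))
        (shiftedSum z + shiftedSum (-z)) ∧
      HasSum (fun k : ℕ => 4 * ((k : ℝ) + 1) * realZeta (2 * k + 3) * z ^ (2 * k + 1))
        (shiftedSum z - shiftedSum (-z)) := by
  have h1 := hasSum_shiftedSum hz
  have h2 := hasSum_shiftedSum (z := -z) (by rwa [abs_neg])
  obtain ⟨a1, b1, e1⟩ := hasSum_even_odd h1
  obtain ⟨a2, b2, e2⟩ := hasSum_even_odd h2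
  have ea : ∀ k : ℕ, (-z) ^ (2 * k) = z ^ (2 * k) := fun k => (even_two_mul k).neg_pow z
  have eb : ∀ k : ℕ, (-z) ^ (2 * k + 1) = -z ^ (2 * k + 1) := fun k =>
    (odd_two_mul_add_one k).neg_pow z
  simp only [ea] at a2 e2
  simp only [eb, mul_neg, tsum_neg] at b2 e2
  constructor
  · rw [← e1, ← e2]
    convert a1.add a1 using 1
    · funext k
      push_cast
      ring
    · ring
  · rw [← e1, ← e2]
    convert b1.add b1 using 1
    · funext k
      push_cast
      ring_nf
    · ring

theorem hasValue_oddZetaSeries {z : ℝ} (hz : |z| < 1) :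
    HasValue oddZetaSeries (z ^ 2) (z / 4 * (shiftedSum z - shiftedSum (-z))) := by
  have h := (hasSum_shiftedSum_parts hz).2.mul_left (z / 4)
  unfold HasValue oddZetaSeries
  rw [← hasSum_nat_add_iff' 1]
  simp only [PowerSeries.coeff_mk, Finset.range_one, Finset.sum_singleton, Nat.cast_zero, zero_mul,
    sub_zero]
  refine h.congr_fun fun k => ?_
  push_cast
  rw [← pow_mul, show 2 * (k + 1) + 1 = 2 * k + 3 by ring]
  ring

theorem hasValue_oddZetaSeriesQuarter {z : ℝ} (hz : |z| < 1) :
    HasValue oddZetaSeriesQuarter (z ^ 2)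
      (z / 8 * (shiftedSum (z / 2) - shiftedSum (-(z / 2)))) := by
  have h := hasValue_oddZetaSeries (z := z / 2) (by
    rw [abs_div, abs_two]
    linarith [abs_nonneg z])
  unfold HasValue oddZetaSeries at h
  unfold HasValue oddZetaSeriesQuarter
  rw [show z / 8 = z / 2 / 4 by ring]
  refine h.congr_fun fun k => ?_
  rw [PowerSeries.coeff_mk, PowerSeries.coeff_mk,
    show (z / 2) ^ 2 = 1 / 4 * z ^ 2 by ring, mul_pow]
  ring

theorem hasValue_evenZetaSeries {z : ℝ} (hz : |z| < 1) :
    HasValue evenZetaSeries (z ^ 2) (z ^ 2 * (shiftedSum z + shiftedSum (-z))) := by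
  have h := (hasSum_shiftedSum_parts hz).1.mul_left (z ^ 2)
  unfold HasValue evenZetaSeries
  rw [← hasSum_nat_add_iff' 1]
  simp only [PowerSeries.coeff_mk, Finset.range_one, Finset.sum_singleton, if_true, zero_mul,
    sub_zero]
  refine h.congr_fun fun k => ?_
  rw [if_neg (by omega)]
  push_cast
  rw [← pow_mul, show 2 * (k + 1) = 2 * k + 2 by ring]
  ring

theorem hasValue_cosSeries (z : ℝ) :
    HasValue cosSeries (z ^ 2) (Real.cos (Real.pi * z) - 1) := by
  have h := (hasSum_nat_add_iff' 1).mpr (Real.hasSum_cos (Real.pi * z))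
  unfold HasValue cosSeries
  rw [← hasSum_nat_add_iff' 1]
  simp only [PowerSeries.coeff_mk, Finset.range_one, Finset.sum_singleton, if_true,
    sub_zero, pow_zero, mul_zero, Nat.factorial_zero, Nat.cast_one, div_one, mul_one] at h ⊢
  refine h.congr_fun fun k => ?_
  rw [if_neg (by omega), mul_pow, ← pow_mul]
  ring

/-- The series of `4 z ^ 2 K(2 z)` in `X = z ^ 2`, where `K` is the generating function. -/
noncomputable def tValueSeries : PowerSeries ℝ :=
  PowerSeries.mk fun m => if m < 2 then 0 else (-4) ^ m * tValue (string323 (m - 2))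

theorem hasValue_tValueSeries (z : ℝ) :
    HasValue tValueSeries (z ^ 2) (4 * z ^ 2 * generating (2 * z)) := by
  have h := (hasSum_generating (2 * z)).mul_left (4 * z ^ 2)
  unfold HasValue tValueSeries
  rw [← hasSum_nat_add_iff' 2]
  simp only [PowerSeries.coeff_mk, Finset.sum_range_succ, Finset.range_zero, Finset.sum_empty,
    Nat.zero_lt_two, Nat.one_lt_two, if_true, zero_mul, sub_zero, add_zero]
  refine h.congr_fun fun k => ?_
  have e : (2 * z) ^ (2 * k + 2) = 4 ^ (k + 1) * (z ^ 2) ^ (k + 1) := by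
    rw [← mul_pow, show 4 * z ^ 2 = (2 * z) ^ 2 by ring, ← pow_mul]
    ring_nf
  rw [if_neg (by omega), Nat.add_sub_cancel, e, neg_pow (4 : ℝ)]
  ring

/-! ### Comparison of coefficients -/

theorem evenPart_eq (z : ℝ) :
    evenPart z = (shiftedSum (z / 2) - shiftedSum (-(z / 2))) / 4 := by
  rw [evenPart, trigammaSum_two_sub, ← sub_neg_eq_add 2 z, trigammaSum_two_sub, neg_div]
  ring

theorem oddPart_add_evenPart (z : ℝ) :
    oddPart z + evenPart z = shiftedSum z - shiftedSum (-z) := by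
  rw [oddPart, evenPart, shiftedSum_eq, shiftedSum_eq, sub_neg_eq_add, sub_neg_eq_add]
  ring

theorem shiftedSum_add_shiftedSum_neg {z : ℝ} (hz : Real.sin (Real.pi * z) ≠ 0) :
    shiftedSum z + shiftedSum (-z) =
      Real.pi ^ 2 / Real.sin (Real.pi * z) ^ 2 - 1 / z ^ 2 := by
  have hs := hz
  rw [sin_pi_mul] at hs
  have hs1 := left_ne_zero_of_mul hs |> right_ne_zero_of_mul
  have hc1 := right_ne_zero_of_mul hs
  have h1 := trigammaSum_reflection hs1
  have h2 := trigammaSum_reflection (z := z + 1) (by rwa [sin_pi_mul_add_one_div_two])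
  rw [sin_pi_mul_add_one_div_two, show 2 - (z + 1) = 1 - z by ring] at h2
  have h3 := trigammaSum_eq_add z
  have h4 : Real.pi ^ 2 / (4 * Real.sin (Real.pi * z / 2) ^ 2) +
      Real.pi ^ 2 / (4 * Real.cos (Real.pi * z / 2) ^ 2) =
      Real.pi ^ 2 / Real.sin (Real.pi * z) ^ 2 := by
    rw [sin_pi_mul]
    have h := Real.sin_sq_add_cos_sq (Real.pi * z / 2)
    field_simp
    linear_combination 4 * h
  rw [← h4, ← h1, ← h2, shiftedSum_eq, shiftedSum_eq, sub_neg_eq_add, sub_neg_eq_add,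
    add_comm 1 z, add_comm 2 z]
  linear_combination -h3

/-- The generating function in terms of zeta values: the closed form, expanded at `z = 0`. -/
theorem tValueSeries_eq :
    tValueSeries = (4 * ∫ p in triangle, weight p) • (X : PowerSeries ℝ) -
      (Real.pi ^ 2 / 8) • evenZetaSeries +
      cosSeries * ((4 : ℝ) • (oddZetaSeries * oddZetaSeries) -
        (2 : ℝ) • (oddZetaSeriesQuarter * oddZetaSeries) -
        (2 : ℝ) • (oddZetaSeries * oddZetaSeriesQuarter)) +
      (2 : ℝ) • (((2 : ℝ) • oddZetaSeries - oddZetaSeriesQuarter) *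
        ((2 : ℝ) • oddZetaSeries - oddZetaSeriesQuarter)) := by
  rw [← sub_eq_zero]
  refine eq_zero_of_hasValue fun w hw => ?_
  obtain ⟨z, hz0, hz1, rfl⟩ : ∃ z : ℝ, 0 < z ∧ z < 1 ∧ z ^ 2 = w := by
    refine ⟨√w, Real.sqrt_pos.mpr hw.1, ?_, Real.sq_sqrt hw.1.le⟩
    rw [Real.sqrt_lt' one_pos, one_pow]
    exact hw.2
  have hz : |z| < 1 := by rwa [abs_of_pos hz0]
  have hsin : Real.sin (Real.pi * z) ≠ 0 :=
    (Real.sin_pos_of_pos_of_lt_pi (by positivity) (by nlinarith [Real.pi_pos])).ne'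
  have hU := hasValue_oddZetaSeries hz
  have hV := hasValue_oddZetaSeriesQuarter hz
  have hE := hasValue_evenZetaSeries hz
  rw [← oddPart_add_evenPart] at hU
  rw [show shiftedSum (z / 2) - shiftedSum (-(z / 2)) = 4 * evenPart z by
    rw [evenPart_eq]; ring] at hV
  rw [shiftedSum_add_shiftedSum_neg hsin] at hE
  have h := (hasValue_tValueSeries z).sub
    (((((hasValue_X (z ^ 2)).smul (4 * ∫ p in triangle, weight p)).sub
      (hE.smul (Real.pi ^ 2 / 8))).add ((hasValue_cosSeries z).mul
        ((((hU.mul hU).smul 4).sub ((hV.mul hU).smul 2)).sub ((hU.mul hV).smul 2)))).add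
      ((((hU.smul 2).sub hV).mul ((hU.smul 2).sub hV)).smul 2))
  convert h using 1
  have hg := generating_two_mul hsin
  have hc := one_sub_cos_pi_mul z
  have hcs := Real.sin_sq_add_cos_sq (Real.pi * z / 2)
  rw [closedForm] at hg
  generalize ∫ p in triangle, weight p = M at *
  generalize oddPart z = o at *
  generalize evenPart z = e at *
  generalize Real.pi ^ 2 / Real.sin (Real.pi * z) ^ 2 - 1 / z ^ 2 = E at *
  have hc' : Real.cos (Real.pi * z) = 1 - 2 * Real.sin (Real.pi * z / 2) ^ 2 := by linarith
  have hcs' : Real.cos (Real.pi * z / 2) ^ 2 = 1 - Real.sin (Real.pi * z / 2) ^ 2 := by linarith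
  rw [hcs'] at hg
  rw [hc']
  linear_combination (-z ^ 2 / 2) * hg

/-- The coefficient of `X ^ (n + 2)` in `tValueSeries_eq`. -/
theorem tValue_eq_sum (n : ℕ) : (-4) ^ (n + 2) * tValue (string323 n) =
    -((9 + 6 * (n : ℝ)) / 2) * (Real.pi ^ 2 / 6) * realZeta (2 * n + 4) +
    ∑ x ∈ Finset.HasAntidiagonal.antidiagonal (n + 2), coeff x.1 cosSeries *
      ∑ y ∈ Finset.HasAntidiagonal.antidiagonal x.2, 2 * (y.1 : ℝ) * y.2 *
        (2 - (1 / 4) ^ y.1 - (1 / 4) ^ y.2) * realZeta (2 * y.1 + 1) * realZeta (2 * y.2 + 1) +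
    ∑ y ∈ Finset.HasAntidiagonal.antidiagonal (n + 2), 2 * (y.1 : ℝ) * y.2 *
        (2 - (1 / 4) ^ y.1) * (2 - (1 / 4) ^ y.2) * realZeta (2 * y.1 + 1) *
          realZeta (2 * y.2 + 1) := by
  have h := congrArg (coeff (n + 2)) tValueSeries_eq
  simp only [map_add, map_sub, PowerSeries.coeff_smul, PowerSeries.coeff_mul, smul_eq_mul,
    PowerSeries.coeff_X, Finset.mul_sum, ← Finset.sum_sub_distrib] at h
  rw [if_neg (by omega), tValueSeries, PowerSeries.coeff_mk, if_neg (by omega),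
    Nat.add_sub_cancel, evenZetaSeries, PowerSeries.coeff_mk, if_neg (by omega)] at h
  rw [h]
  simp only [Finset.mul_sum]
  congr 1
  · congr 1
    · push_cast
      rw [show 2 * (n + 2) = 2 * n + 4 by ring]
      ring
    · refine Finset.sum_congr rfl fun x _ => Finset.sum_congr rfl fun y _ => ?_
      simp only [oddZetaSeries, oddZetaSeriesQuarter, PowerSeries.coeff_mk]
      ring
  · refine Finset.sum_congr rfl fun y _ => ?_
    simp only [oddZetaSeries, oddZetaSeriesQuarter, PowerSeries.coeff_mk]
    ring

/-- Indices may be allowed to vanish when the summand then does. -/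
theorem sum_filter_pairs {m : ℕ} (g : ℕ → ℕ → ℂ) (h1 : ∀ s, g 0 s = 0) (h2 : ∀ r, g r 0 = 0) :
    ∑ x ∈ (Finset.Icc 1 m ×ˢ Finset.Icc 1 m).filter (fun x : ℕ × ℕ => x.1 + x.2 = m),
      g x.1 x.2 = ∑ x ∈ Finset.HasAntidiagonal.antidiagonal m, g x.1 x.2 := by
  refine Finset.sum_subset (fun x hx => ?_) fun x hx hx' => ?_
  · exact Finset.HasAntidiagonal.mem_antidiagonal.mpr (Finset.mem_filter.mp hx).2
  · have h := Finset.HasAntidiagonal.mem_antidiagonal.mp hx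
    obtain h0 | h0 : x.1 = 0 ∨ x.2 = 0 := by
      by_contra! h0
      refine hx' ?_
      simp only [Finset.mem_filter, Finset.mem_product, Finset.mem_Icc]
      omega
    · rw [h0, h1]
    · rw [h0, h2]

theorem sum_filter_triples {m : ℕ} (g : ℕ → ℕ → ℕ → ℂ) (h0 : ∀ r s, g 0 r s = 0)
    (h1 : ∀ q s, g q 0 s = 0) (h2 : ∀ q r, g q r 0 = 0) :
    ∑ x ∈ (Finset.Icc 1 m ×ˢ Finset.Icc 1 m ×ˢ Finset.Icc 1 m).filter
        (fun x : ℕ × ℕ × ℕ => x.1 + x.2.1 + x.2.2 = m), g x.1 x.2.1 x.2.2 =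
      ∑ x ∈ Finset.HasAntidiagonal.antidiagonal m,
        ∑ y ∈ Finset.HasAntidiagonal.antidiagonal x.2, g x.1 y.1 y.2 := by
  rw [Finset.sum_sigma']
  refine Finset.sum_of_injOn
    (fun x => ⟨(x.1, x.2.1 + x.2.2), (x.2.1, x.2.2)⟩) ?_ ?_ ?_ ?_
  · rintro ⟨a, b, c⟩ _ ⟨a', b', c'⟩ _ h
    simp only [Sigma.mk.injEq, Prod.mk.injEq, heq_eq_eq] at h
    simp only [Prod.mk.injEq]
    exact ⟨h.1.1, h.2⟩
  · rintro ⟨a, b, c⟩ h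
    simp only [Finset.coe_filter, Set.mem_ofPred_eq] at h
    simp only [Finset.mem_coe, Finset.mem_sigma, Finset.HasAntidiagonal.mem_antidiagonal, and_true]
    omega
  · rintro ⟨⟨q, p⟩, ⟨r, s⟩⟩ hx hx'
    simp only [Finset.mem_sigma, Finset.HasAntidiagonal.mem_antidiagonal] at hx
    obtain h | h | h : q = 0 ∨ r = 0 ∨ s = 0 := by
      by_contra! h
      refine hx' ⟨(q, r, s), ?_, ?_⟩
      · simp only [Finset.coe_filter, Set.mem_ofPred_eq, Finset.mem_product, Finset.mem_Icc]
        omega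
      · simp only [hx.2]
    · simp only [h, h0]
    · simp only [h, h1]
    · simp only [h, h2]
  · rintro ⟨a, b, c⟩ _
    rfl

theorem two_zpow_neg (r : ℕ) : (2 : ℂ) ^ (-(2 * (r : ℤ))) = (1 / 4) ^ r := by
  rw [zpow_neg, zpow_mul, zpow_natCast, one_div, inv_pow]
  norm_num

theorem ofReal_realZeta_odd {r : ℕ} (hr : r ≠ 0) :
    (realZeta (2 * r + 1) : ℂ) = riemannZeta (2 * (r : ℂ) + 1) := by
  rw [ofReal_realZeta (by omega)]
  push_cast
  rfl

theorem tValue_string323_eq (n : ℕ) : (tValue (string323 n) : ℂ) =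
    (-1 / 4 : ℂ) ^ (n + 2) *
      (-((9 + 6 * (n : ℂ)) / 2) * riemannZeta 2 * riemannZeta (2 * (n : ℂ) + 4)
        + ∑ x ∈ (Finset.Icc 1 (n + 2) ×ˢ Finset.Icc 1 (n + 2) ×ˢ Finset.Icc 1 (n + 2)).filter
              (fun x : ℕ × ℕ × ℕ => x.1 + x.2.1 + x.2.2 = n + 2),
            (fun q r s : ℕ =>
              2 * (r : ℂ) * (s : ℂ)
                * (2 - (2 : ℂ) ^ (-(2 * (r : ℤ))) - (2 : ℂ) ^ (-(2 * (s : ℤ))))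
                * riemannZeta (2 * (r : ℂ) + 1) * riemannZeta (2 * (s : ℂ) + 1)
                * ((-1 : ℂ) ^ q * ((Real.pi : ℂ) ^ (2 * q) / (Nat.factorial (2 * q) : ℂ))))
              x.1 x.2.1 x.2.2
        + ∑ x ∈ (Finset.Icc 1 (n + 2) ×ˢ Finset.Icc 1 (n + 2)).filter
              (fun x : ℕ × ℕ => x.1 + x.2 = n + 2),
            (fun r s : ℕ =>
              2 * (r : ℂ) * (s : ℂ)
                * (2 - (2 : ℂ) ^ (-(2 * (r : ℤ)))) * (2 - (2 : ℂ) ^ (-(2 * (s : ℤ))))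
                * riemannZeta (2 * (r : ℂ) + 1) * riemannZeta (2 * (s : ℂ) + 1))
              x.1 x.2) := by
  have h := congrArg (fun t : ℝ => (-1 / 4 : ℂ) ^ (n + 2) * (t : ℂ)) (tValue_eq_sum n)
  simp only [Complex.ofReal_mul, ← mul_assoc, Complex.ofReal_pow] at h
  rw [← mul_pow, show (-1 / 4 : ℂ) * ((-4 : ℝ) : ℂ) = 1 by push_cast; norm_num, one_pow,
    one_mul] at h
  rw [h]
  congr 1
  rw [Complex.ofReal_add, Complex.ofReal_add]
  congr 1
  · congr 1
    · rw [Complex.ofReal_mul, ofReal_realZeta (by omega), riemannZeta_two]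
      push_cast
      rfl
    · -- The summand with `q = 0` is absent, in accordance with the constant term of `cosSeries`.
      have hc0 : coeff 0 cosSeries = 0 := by rw [cosSeries, PowerSeries.coeff_mk, if_pos rfl]
      have h3 := sum_filter_triples (m := n + 2) (fun q r s : ℕ =>
        ((coeff q cosSeries : ℝ) : ℂ) * (2 * (r : ℂ) * (s : ℂ) * (2 - (1 / 4) ^ r - (1 / 4) ^ s) *
          realZeta (2 * r + 1) * realZeta (2 * s + 1))) (by simp only [hc0]; simp) (by simp)
          (by simp)
      refine Eq.trans ?_ (h3.symm.trans ?_)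
      · simp only [← Finset.mul_sum]
        push_cast
        rfl
      · refine Finset.sum_congr rfl fun x hx => ?_
        simp only [Finset.mem_filter, Finset.mem_product, Finset.mem_Icc] at hx
        simp only [two_zpow_neg]
        rw [ofReal_realZeta_odd (by omega), ofReal_realZeta_odd (by omega), cosSeries,
          PowerSeries.coeff_mk, if_neg (by omega)]
        push_cast
        ring
  · have h2 := sum_filter_pairs (m := n + 2) (fun r s : ℕ =>
      2 * (r : ℂ) * (s : ℂ) * (2 - (1 / 4) ^ r) * (2 - (1 / 4) ^ s) *
        realZeta (2 * r + 1) * realZeta (2 * s + 1)) (by simp) (by simp)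
    refine Eq.trans ?_ (h2.symm.trans ?_)
    · push_cast
      rfl
    · refine Finset.sum_congr rfl fun x hx => ?_
      simp only [Finset.mem_filter, Finset.mem_product, Finset.mem_Icc] at hx
      simp only [two_zpow_neg]
      rw [ofReal_realZeta_odd (by omega), ofReal_realZeta_odd (by omega)]

theorem tValue_string323_mem_adjoin (n : ℕ) : (tValue (string323 n) : ℂ) ∈
    Algebra.adjoin ℚ {z : ℂ | ∃ k : ℕ, 2 ≤ k ∧ z = riemannZeta (k : ℂ)} := by
  set S := Algebra.adjoin ℚ {z : ℂ | ∃ k : ℕ, 2 ≤ k ∧ z = riemannZeta (k : ℂ)}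
  have hzeta : ∀ k : ℕ, 2 ≤ k → riemannZeta (k : ℂ) ∈ S := fun k hk =>
    Algebra.subset_adjoin ⟨k, hk, rfl⟩
  have hrat : ∀ q : ℚ, (q : ℂ) ∈ S := fun q => S.algebraMap_mem q
  have hnat : ∀ k : ℕ, (k : ℂ) ∈ S := fun k => natCast_mem S k
  have hodd : ∀ r : ℕ, r ≠ 0 → riemannZeta (2 * (r : ℂ) + 1) ∈ S := fun r hr => by
    have := hzeta (2 * r + 1) (by omega)
    push_cast at this
    exact this
  have h2 : (2 : ℂ) ∈ S := by exact_mod_cast hnat 2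
  have hpi : (Real.pi : ℂ) ^ 2 ∈ S := by
    have h := S.mul_mem (hnat 6) (hzeta 2 le_rfl)
    push_cast at h
    rwa [riemannZeta_two, mul_div_cancel₀ _ (by norm_num)] at h
  have hquarter : (1 / 4 : ℂ) ∈ S := by
    have := hrat (1 / 4)
    push_cast at this
    exact this
  have hfact : ∀ k : ℕ, ((k.factorial : ℂ))⁻¹ ∈ S := fun k => by
    have := hrat (k.factorial : ℚ)⁻¹
    push_cast at this
    exact this
  rw [tValue_string323_eq]
  refine S.mul_mem (S.pow_mem ?_ _) (S.add_mem (S.add_mem ?_ ?_) ?_)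
  · rw [neg_div]
    exact S.neg_mem hquarter
  · refine S.mul_mem (S.mul_mem (S.neg_mem ?_) ?_) ?_
    · have := hrat ((9 + 6 * n) / 2)
      push_cast at this
      exact this
    · exact_mod_cast hzeta 2 le_rfl
    · have := hzeta (2 * n + 4) (by omega)
      push_cast at this
      exact this
  · refine S.sum_mem fun x hx => ?_
    simp only [Finset.mem_filter, Finset.mem_product, Finset.mem_Icc] at hx
    simp only [two_zpow_neg, pow_mul, div_eq_mul_inv _ ((Nat.factorial _ : ℕ) : ℂ)]
    exact S.mul_mem (S.mul_mem (S.mul_mem (S.mul_mem (S.mul_mem h2 (hnat _)) (hnat _))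
      (S.sub_mem (S.sub_mem h2 (S.pow_mem hquarter _)) (S.pow_mem hquarter _)))
      (hodd _ (by omega))) (hodd _ (by omega)) |> fun h => S.mul_mem h
        (S.mul_mem (S.pow_mem (S.neg_mem S.one_mem) _) (S.mul_mem (S.pow_mem hpi _) (hfact _)))
  · refine S.sum_mem fun x hx => ?_
    simp only [Finset.mem_filter, Finset.mem_product, Finset.mem_Icc] at hx
    simp only [two_zpow_neg]
    exact S.mul_mem (S.mul_mem (S.mul_mem (S.mul_mem (S.mul_mem (S.mul_mem h2 (hnat _)) (hnat _))
      (S.sub_mem h2 (S.pow_mem hquarter _))) (S.sub_mem h2 (S.pow_mem hquarter _)))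
      (hodd _ (by omega))) (hodd _ (by omega))

end MultipleT

theorem theorem3p1 (n : ℕ) :
    Summable (MultipleT.tTerm (MultipleT.string323 n)) ∧
    (MultipleT.tValue (MultipleT.string323 n) : ℂ) =
      (-1 / 4 : ℂ) ^ (n + 2) *
        (-((9 + 6 * (n : ℂ)) / 2) * riemannZeta 2 * riemannZeta (2 * (n : ℂ) + 4)
          + ∑ x ∈ (Finset.Icc 1 (n + 2) ×ˢ Finset.Icc 1 (n + 2) ×ˢ Finset.Icc 1 (n + 2)).filter
                (fun x : ℕ × ℕ × ℕ => x.1 + x.2.1 + x.2.2 = n + 2),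
              (fun q r s : ℕ =>
                2 * (r : ℂ) * (s : ℂ)
                  * (2 - (2 : ℂ) ^ (-(2 * (r : ℤ))) - (2 : ℂ) ^ (-(2 * (s : ℤ))))
                  * riemannZeta (2 * (r : ℂ) + 1) * riemannZeta (2 * (s : ℂ) + 1)
                  * ((-1 : ℂ) ^ q * ((Real.pi : ℂ) ^ (2 * q) / (Nat.factorial (2 * q) : ℂ))))
                x.1 x.2.1 x.2.2
          + ∑ x ∈ (Finset.Icc 1 (n + 2) ×ˢ Finset.Icc 1 (n + 2)).filter
                (fun x : ℕ × ℕ => x.1 + x.2 = n + 2),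
              (fun r s : ℕ =>
                2 * (r : ℂ) * (s : ℂ)
                  * (2 - (2 : ℂ) ^ (-(2 * (r : ℤ)))) * (2 - (2 : ℂ) ^ (-(2 * (s : ℤ))))
                  * riemannZeta (2 * (r : ℂ) + 1) * riemannZeta (2 * (s : ℂ) + 1))
                x.1 x.2) ∧
    (MultipleT.tValue (MultipleT.string323 n) : ℂ) ∈
      Algebra.adjoin ℚ {z : ℂ | ∃ k : ℕ, 2 ≤ k ∧ z = riemannZeta (k : ℂ)} := by
  exact ⟨MultipleT.summable_tTerm_string323 n, MultipleT.tValue_string323_eq n,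
    MultipleT.tValue_string323_mem_adjoin n⟩
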